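/- For a finite set $P\subset\mathbb R^d$ and $1\le k\le |P|$ let $$\mathrm d_{P,k}(x)=\Big(\tfrac1k\min_{T\subseteq P,\ |T|=k}\ \sum_{p\in T}\|x-p\|^2\Big)^{1/2},\qquad x\in\mathbb R^d .$$ For a nonempty finite set $Q\subset\mathbb R^d$ (the sites) and weights $w_q\ge 0$ ($q\in Q$) let $\phi_Q^w(x)=\big(\min_{q\in Q}(\|x-q\|^2+w_q)\big)^{1/2}$; functions of this form are called distance-like. For $\phi:\mathbb R^d\to\mathbb R$ and $\varepsilon\ge0$, the $\varepsilon$-complexity $\mathcal N(\phi,\varepsilon)$ is the minimum of $|Q|$ over all distance-like functions $\phi_Q^w$ with $\|\phi-\phi_Q^w\|_\infty\le\varepsilon$. Let $m_d=\mathbb E|X\cdot u|$, where $X$ is uniformly distributed on the unit sphere of $\mathbb R^d$ and $u$ is an arbitrary unit vector (the value does not depend on $u$). **Theorem.** For every $\kappa>0$ there is a constant $C_\kappa>0$, depending only on $\kappa$, such that the following holds. Let $d\ge2$ be an integer and $\eta>0$ with $d\ge 1/\eta^2$, and suppose that $N=\frac{d}{\eta^2}(\log d+C_\kappa)$ is an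 integer. Let $p_1,\dots,p_N$ be independent random points, uniformly distributed on the unit sphere of $\mathbb R^d$, and let $S=\{\pm p_i:\ 1\le i\le N\}$. Then, with probability at least $1-\exp(-\kappa d)$, $$\mathcal N\big(\mathrm d_{S,N},\,m_d\,\eta\big)\ \ge\ 2\sqrt d\,\left(\frac{N}{64\,d\,(\log d+C_\kappa)}\right)^{\frac{d-1}{4}} .$$ -/

import Mathlib

open MeasureTheory ProbabilityTheory Metric

/-- Euclidean space of dimension `d`. -/
abbrev Euc (d : ℕ) : Type := EuclideanSpace ℝ (Fin d)

/-- The function `φ_Q^w(x) = (min_{q ∈ Q} (‖x - q‖² + w_q))^{1/2}`. It is used only for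
nonempty finite `Q` and for weights that are nonnegative on `Q`. -/
noncomputable def powerDist {d : ℕ} (Q : Finset (Euc d)) (w : Euc d → ℝ) (x : Euc d) : ℝ :=
  Real.sqrt (⨅ q : {q // q ∈ Q}, (‖x - q.1‖ ^ 2 + w q.1))

/-- The `k`-distance to the finite point set `P`: the square root of `1/k` times the minimum, over
the sets `T` of `k` distinct points of `P`, of `∑_{p ∈ T} ‖x - p‖²`. -/
noncomputable def kDist {d : ℕ} (P : Finset (Euc d)) (k : ℕ) (x : Euc d) : ℝ :=
  Real.sqrt ((1 / (k : ℝ)) *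
    ⨅ T : {T // T ∈ P.powersetCard k}, ∑ p ∈ T.1, ‖x - p‖ ^ 2)

/-- `ApproxBySites φ ε n`: some distance-like function with exactly `n` sites, i.e. some `φ_Q^w`
with `Q` finite and nonempty, `|Q| = n` and nonnegative weights, satisfies
`‖φ - φ_Q^w‖_∞ ≤ ε`. -/
def ApproxBySites {d : ℕ} (φ : Euc d → ℝ) (ε : ℝ) (n : ℕ) : Prop :=
  ∃ (Q : Finset (Euc d)) (w : Euc d → ℝ), Q.Nonempty ∧ (∀ q ∈ Q, 0 ≤ w q) ∧ Q.card = n ∧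
    ∀ x, |φ x - powerDist Q w x| ≤ ε

/-- The `ε`-complexity of `φ`: the least number of sites of a distance-like function at uniform
distance at most `ε` from `φ`. -/
noncomputable def epsComplexity {d : ℕ} (φ : Euc d → ℝ) (ε : ℝ) : ℕ :=
  sInf {n : ℕ | ApproxBySites φ ε n}

open Classical in
/-- The symmetrization `P ∪ (-P)` of the point cloud `P = {p_i}`. -/
noncomputable def symmCloud {d N : ℕ} (p : Fin N → sphere (0 : Euc d) 1) : Finset (Euc d) :=
  Finset.univ.image (fun i => (p i : Euc d)) ∪ Finset.univ.image (fun i => -(p i : Euc d))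

/-- The uniform probability measure on the unit sphere of `ℝ^d` (for `d ≥ 1`): the surface measure
divided by its total mass. -/
noncomputable def uniformSphere (d : ℕ) : Measure (sphere (0 : Euc d) 1) :=
  ((volume : Measure (Euc d)).toSphere Set.univ)⁻¹ • (volume : Measure (Euc d)).toSphere

/-- `𝔼 |X · u|` for `X` uniform on the unit sphere of `ℝ^d`. For every unit vector `u` this is
the number `m_d`. -/
noncomputable def meanAbsInner {d : ℕ} (u : Euc d) : ℝ :=
  ∫ x, |inner ℝ (x : Euc d) u| ∂(uniformSphere d)

/-! Far from the origin a distance-like function only sees the support function of its sites: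
`powerDist Q w (r • u) - r` tends to `-supportFn Q u`. Hence two distance-like functions at uniform
distance `ε` have support functions `ε`-close on the unit sphere (`abs_supportFn_sub_le`).

The `N`-distance to `S` is itself distance-like; its sites are the barycentres of the `N`-subsets of
`S` (`kDist_eq_powerDist`). The best `N`-subset in direction `u` picks the right sign of every
`p_i`, so the support function is that of a zonotope, `meanAbs p u`, the average of `|⟨u, p_i⟩|`
(`supportFn_barycenters`). For random points it is uniformly close to `m_d`: the zonotope is nearly
a ball (`measure_exists_abs_meanAbs_sub_gt_le`).

An admissible `Q` then has an almost constant support function, so its directions cover the sphere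
by caps of cosine near `1`. Comparing volumes gives `|Q| ≥ (6η)^(-(d-1)/2)`
(`one_le_card_mul_of_supportFn`). The asserted bound equals `2√d (8η)^(-(d-1)/2)`, and
`(3/4)^((d-1)/2)` absorbs `2√d` once `d > 25`. The remaining cases need only one or two sites.

The deviation bound takes no union bound over a net. Symmetrization and contraction replace the
maximum of the centred sums of `|⟨t, p_i⟩|` by `2‖∑ p_i‖` in exponential moments, and this norm has
a Gaussian-type moment. Only the constant in `log d + C` is used for the probability. -/

/-! ### Volume of spherical sectors and covering by caps. -/

section Caps

variable {d : ℕ}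

/-- The linear map scaling the line spanned by the unit vector `v` by `t⁻¹` and its orthogonal
complement by `s⁻¹`. -/
noncomputable def axialScaling (v : Euc d) (s t : ℝ) : Euc d →ₗ[ℝ] Euc d :=
  s⁻¹ • LinearMap.transvection ((s / t - 1) • (innerₛₗ ℝ v)) v

lemma axialScaling_apply (v : Euc d) {s t : ℝ} (hs : s ≠ 0) (x : Euc d) :
    axialScaling v s t x = s⁻¹ • (x - inner ℝ v x • v) + (inner ℝ v x / t) • v := by
  simp only [axialScaling, LinearMap.smul_apply, LinearMap.transvection.apply, innerₛₗ_apply_apply,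
    smul_eq_mul, smul_add, smul_sub, smul_smul, sub_add, ← sub_smul]
  rw [sub_eq_add_neg (s⁻¹ • x), ← neg_smul]
  congr 2
  field_simp
  ring

/-- A transvection `x ↦ x + f x • v` has determinant `1 + f v`, here `s / t`; the scalar factor
contributes `s⁻¹` to the power `d`. -/
lemma det_axialScaling {v : Euc d} (hv : ‖v‖ = 1) {s t : ℝ} (hs : s ≠ 0) (hd : 1 ≤ d) :
    LinearMap.det (axialScaling v s t) = (s ^ (d - 1) * t)⁻¹ := by
  obtain ⟨k, rfl⟩ := Nat.exists_eq_add_of_le' hd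
  rw [axialScaling, LinearMap.det_smul, LinearMap.transvection.det]
  simp only [finrank_euclideanSpace, Fintype.card_fin, LinearMap.smul_apply, innerₛₗ_apply_apply,
    real_inner_self_eq_norm_sq, hv, smul_eq_mul, Nat.add_sub_cancel, pow_succ, mul_one,
    mul_inv, inv_pow]
  field_simp
  ring

/-- The sector lies in the ellipsoid centred at `t • v` with semi-axis `t` along `v` and `√(1 - t²)`
across. Its boundary passes through the apex `0` and the rim of the cap; the pole `v` lies inside
exactly because `t ≥ 1/2`. -/
lemma norm_axialScaling_sub_le {v : Euc d} (hv : ‖v‖ = 1) {t : ℝ} (ht : 1 / 2 ≤ t) (ht1 : t < 1)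
    {x : Euc d} (hx : ‖x‖ ≤ 1) (hxv : t * ‖x‖ ≤ inner ℝ v x) :
    ‖axialScaling v (Real.sqrt (1 - t ^ 2)) t x - v‖ ≤ 1 := by
  have ht2 : 0 < 1 - t ^ 2 := by nlinarith
  set s := Real.sqrt (1 - t ^ 2) with hs
  have hs0 : 0 < s := Real.sqrt_pos.2 ht2
  have hs2 : s ^ 2 = 1 - t ^ 2 := Real.sq_sqrt ht2.le
  set a : ℝ := inner ℝ v x with ha
  have hxa : inner ℝ x v = a := real_inner_comm _ _
  have e1 : axialScaling v s t x - v = s⁻¹ • (x - a • v) + (a / t - 1) • v := by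
    rw [axialScaling_apply v hs0.ne', sub_smul, one_smul, add_sub_assoc]
  have horth : inner ℝ (x - a • v) v = 0 := by
    rw [inner_sub_left, inner_smul_left, real_inner_self_eq_norm_sq, hv, hxa]
    simp
  have hperp : ‖x - a • v‖ ^ 2 = ‖x‖ ^ 2 - a ^ 2 := by
    rw [norm_sub_sq_real, inner_smul_right, hxa, norm_smul, hv]
    simp only [Real.norm_eq_abs, mul_one, sq_abs]
    ring
  have hsq : ‖axialScaling v s t x - v‖ ^ 2 =
      (‖x‖ ^ 2 - a ^ 2) / (1 - t ^ 2) + (a / t - 1) ^ 2 := by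
    rw [e1, norm_add_sq_real, inner_smul_left, inner_smul_right, horth, norm_smul, norm_smul,
      mul_pow, mul_pow, hperp, hv]
    simp only [Real.norm_eq_abs, sq_abs, mul_zero, inv_pow, hs2]
    ring
  have ha1 : a ≤ ‖x‖ := by
    have := real_inner_le_norm v x
    rwa [hv, one_mul] at this
  have hρ := norm_nonneg x
  have ha0 : 0 ≤ a := le_trans (by positivity) hxv
  have key : t ^ 2 * ‖x‖ ^ 2 + (1 - 2 * t ^ 2) * a ^ 2 ≤ 2 * a * t * (1 - t ^ 2) := by
    have h1 : 0 ≤ t * ‖x‖ - (1 - 2 * t ^ 2) * a := by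
      rcases le_or_gt (1 - 2 * t ^ 2) 0 with h | h
      · have := mul_nonneg (neg_nonneg.2 h) ha0
        have : 0 ≤ t * ‖x‖ := by positivity
        nlinarith
      · have h3 : (1 - 2 * t ^ 2) * a ≤ (1 - 2 * t ^ 2) * ‖x‖ :=
          mul_le_mul_of_nonneg_left ha1 h.le
        have h4 : 0 ≤ (2 * t - 1) * (t + 1) * ‖x‖ :=
          mul_nonneg (mul_nonneg (by linarith) (by linarith)) hρ
        nlinarith
    -- Expanded, this is `key` with an extra factor `‖x‖` on the right; `h5` removes it using `‖x‖ ≤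
    -- 1`.
    have h2 : 0 ≤ (a - t * ‖x‖) * (t * ‖x‖ - (1 - 2 * t ^ 2) * a) :=
      mul_nonneg (by linarith) h1
    have h5 : 0 ≤ 2 * a * t * (1 - t ^ 2) * (1 - ‖x‖) :=
      mul_nonneg (by positivity) (by linarith)
    nlinarith
  have hle : ‖axialScaling v s t x - v‖ ^ 2 ≤ 1 := by
    rw [hsq]
    have ht0 : 0 < t := by linarith
    have : (‖x‖ ^ 2 - a ^ 2) / (1 - t ^ 2) + (a / t - 1) ^ 2 - 1 =
        (t ^ 2 * ‖x‖ ^ 2 + (1 - 2 * t ^ 2) * a ^ 2 - 2 * a * t * (1 - t ^ 2)) /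
          (t ^ 2 * (1 - t ^ 2)) := by
      field_simp
      ring
    have h6 : (t ^ 2 * ‖x‖ ^ 2 + (1 - 2 * t ^ 2) * a ^ 2 - 2 * a * t * (1 - t ^ 2)) /
          (t ^ 2 * (1 - t ^ 2)) ≤ 0 :=
      div_nonpos_of_nonpos_of_nonneg (by linarith) (by positivity)
    linarith
  nlinarith [norm_nonneg (axialScaling v s t x - v)]

/-- A spherical sector of half-angle `arccos t` has at most the fraction `(1 - t²)^((d-1)/2)` of the
volume of the unit ball. -/
lemma volume_sector_le {v : Euc d} (hv : ‖v‖ = 1) {t : ℝ} (ht : 1 / 2 ≤ t) (ht1 : t < 1)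
    (hd : 1 ≤ d) :
    volume {x : Euc d | ‖x‖ ≤ 1 ∧ t * ‖x‖ ≤ inner ℝ v x} ≤
      ENNReal.ofReal (Real.sqrt (1 - t ^ 2) ^ (d - 1)) * volume (closedBall (0 : Euc d) 1) := by
  have hs0 : 0 < Real.sqrt (1 - t ^ 2) := Real.sqrt_pos.2 (by nlinarith)
  set s := Real.sqrt (1 - t ^ 2) with hs
  have hdet := det_axialScaling (t := t) hv hs0.ne' hd
  have hpos : 0 < s ^ (d - 1) * t := mul_pos (pow_pos hs0 _) (by linarith)
  calc volume {x : Euc d | ‖x‖ ≤ 1 ∧ t * ‖x‖ ≤ inner ℝ v x}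
      ≤ volume (axialScaling v s t ⁻¹' closedBall v 1) := by
        refine measure_mono fun x hx => ?_
        rw [Set.mem_preimage, mem_closedBall, dist_eq_norm]
        exact norm_axialScaling_sub_le hv ht ht1 hx.1 hx.2
    _ = ENNReal.ofReal (s ^ (d - 1) * t) * volume (closedBall (0 : Euc d) 1) := by
        rw [Measure.addHaar_preimage_linearMap _ (by rw [hdet]; positivity), hdet, inv_inv,
          abs_of_pos hpos, Measure.addHaar_closedBall_center]
    _ ≤ _ := by
        gcongr
        exact mul_le_of_le_one_right (by positivity) ht1.le

/-- If every direction is within angle `arccos t` of a point of `Q`, then `Q` has at least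
`(1 - t²)^(-(d-1)/2)` points. -/
lemma one_le_card_mul_of_cover (hd : 1 ≤ d) {Q : Finset (Euc d)} {R t : ℝ} (hR : 0 < R)
    (ht : 1 / 2 ≤ t) (ht1 : t < 1) (hQ : ∀ q ∈ Q, ‖q‖ ≤ R)
    (hcov : ∀ u : Euc d, ‖u‖ = 1 → ∃ q ∈ Q, t * R ≤ inner ℝ u q) :
    1 ≤ Q.card * Real.sqrt (1 - t ^ 2) ^ (d - 1) := by
  have : Nontrivial (Euc d) := by
    have : Nonempty (Fin d) := ⟨⟨0, hd⟩⟩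
    infer_instance
  set s := Real.sqrt (1 - t ^ 2) with hs
  let Q' := Q.filter (fun q => q ≠ 0)
  have hcov' : closedBall (0 : Euc d) 1 ⊆
      ⋃ q ∈ Q', {x : Euc d | ‖x‖ ≤ 1 ∧ t * ‖x‖ ≤ inner ℝ (‖q‖⁻¹ • q) x} := by
    have aux : ∀ u : Euc d, ‖u‖ = 1 → ∃ q ∈ Q', t ≤ inner ℝ (‖q‖⁻¹ • q) u := by
      intro u hu
      obtain ⟨q, hq, hqu⟩ := hcov u hu
      have hq0 : q ≠ 0 := by
        rintro rfl
        rw [inner_zero_right] at hqu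
        nlinarith
      refine ⟨q, by simp [Q', hq, hq0], ?_⟩
      have hqn : 0 < ‖q‖ := norm_pos_iff.2 hq0
      rw [real_inner_smul_left, real_inner_comm, inv_mul_eq_div, le_div_iff₀ hqn]
      exact le_trans (mul_le_mul_of_nonneg_left (hQ q hq) (by linarith)) hqu
    intro x hx
    rw [mem_closedBall, dist_zero_right] at hx
    simp only [Set.mem_iUnion, Set.mem_ofPred_eq, exists_prop]
    rcases eq_or_ne x 0 with rfl | hx0
    -- The origin lies in every sector, so only some nonzero site is needed.
    · obtain ⟨u, hu⟩ := exists_norm_eq (Euc d) zero_le_one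
      obtain ⟨q, hq, -⟩ := aux u hu
      exact ⟨q, hq, by simp, by simp⟩
    · have hxn : 0 < ‖x‖ := norm_pos_iff.2 hx0
      obtain ⟨q, hq, hqx⟩ := aux (‖x‖⁻¹ • x) (by simp [norm_smul, hxn.ne'])
      refine ⟨q, hq, hx, ?_⟩
      rw [inner_smul_right, inv_mul_eq_div, le_div_iff₀ hxn] at hqx
      exact hqx
  set V := volume (closedBall (0 : Euc d) 1) with hV
  have hV0 : V ≠ 0 := (measure_closedBall_pos _ _ one_pos).ne'
  have hVt : V ≠ ⊤ := measure_closedBall_lt_top.ne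
  have hle : V ≤ ENNReal.ofReal (Q.card * s ^ (d - 1)) * V := by
    calc V ≤ ∑ q ∈ Q', volume {x : Euc d | ‖x‖ ≤ 1 ∧ t * ‖x‖ ≤ inner ℝ (‖q‖⁻¹ • q) x} :=
          (measure_mono hcov').trans (measure_biUnion_finset_le _ _)
      _ ≤ ∑ q ∈ Q', ENNReal.ofReal (s ^ (d - 1)) * V := by
          refine Finset.sum_le_sum fun q hq => volume_sector_le ?_ ht ht1 hd
          have hq0 : q ≠ 0 := (Finset.mem_filter.1 hq).2
          simp [norm_smul, hq0]
      _ ≤ ∑ q ∈ Q, ENNReal.ofReal (s ^ (d - 1)) * V :=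
          Finset.sum_le_sum_of_subset (Finset.filter_subset _ _)
      _ = _ := by
          rw [Finset.sum_const, nsmul_eq_mul, ← mul_assoc, ENNReal.ofReal_mul (by positivity),
            ENNReal.ofReal_natCast]
  have h1 : 1 ≤ ENNReal.ofReal (Q.card * s ^ (d - 1)) := by
    have : 1 * V ≤ ENNReal.ofReal (Q.card * s ^ (d - 1)) * V := by rwa [one_mul]
    exact (ENNReal.mul_le_mul_iff_left hV0 hVt).1 this
  exact ENNReal.one_le_ofReal.1 h1

end Caps

/-! ### Distance-like functions, support functions and the zonotope. -/

section Sites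

variable {d : ℕ}

/-- The support function of (the convex hull of) the finite set `Q`. -/
noncomputable def supportFn (Q : Finset (Euc d)) (u : Euc d) : ℝ :=
  ⨆ q : {q // q ∈ Q}, inner ℝ u q.1

lemma inner_le_supportFn {Q : Finset (Euc d)} {q : Euc d} (hq : q ∈ Q) (u : Euc d) :
    inner ℝ u q ≤ supportFn Q u :=
  le_ciSup (f := fun q : {q // q ∈ Q} => (inner ℝ u q.1 : ℝ)) (Set.finite_range _).bddAbove ⟨q, hq⟩

lemma exists_inner_eq_supportFn {Q : Finset (Euc d)} (hQ : Q.Nonempty) (u : Euc d) :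
    ∃ q ∈ Q, inner ℝ u q = supportFn Q u := by
  have : Nonempty {q // q ∈ Q} := hQ.to_subtype
  obtain ⟨q, hq⟩ := exists_eq_ciSup_of_finite (f := fun q : {q // q ∈ Q} => (inner ℝ u q.1 : ℝ))
  exact ⟨q.1, q.2, hq⟩

/-- Expanding the square leaves `‖q‖² + w q` as the only part independent of `r`. It is nonnegative,
and at most its sum over all sites, which serves as `B`. -/
lemma powerDist_sq_bounds {Q : Finset (Euc d)} (hQ : Q.Nonempty) {w : Euc d → ℝ}
    (hw : ∀ q ∈ Q, 0 ≤ w q) :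
    ∃ B : ℝ, ∀ u : Euc d, ‖u‖ = 1 → ∀ r : ℝ, 0 ≤ r →
      r ^ 2 - 2 * r * supportFn Q u ≤ powerDist Q w (r • u) ^ 2 ∧
        powerDist Q w (r • u) ^ 2 ≤ r ^ 2 - 2 * r * supportFn Q u + B := by
  have : Nonempty {q // q ∈ Q} := hQ.to_subtype
  refine ⟨∑ q ∈ Q, (‖q‖ ^ 2 + w q), fun u hu r hr => ?_⟩
  have hB : ∀ q ∈ Q, ‖q‖ ^ 2 + w q ≤ ∑ q ∈ Q, (‖q‖ ^ 2 + w q) := fun q hq =>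
    Finset.single_le_sum (f := fun q : Euc d => ‖q‖ ^ 2 + w q)
      (fun q hq => add_nonneg (sq_nonneg _) (hw q hq)) hq
  have hexp : ∀ q : Euc d, ‖r • u - q‖ ^ 2 + w q =
      r ^ 2 - 2 * r * inner ℝ u q + (‖q‖ ^ 2 + w q) := by
    intro q
    rw [norm_sub_sq_real, norm_smul, hu, real_inner_smul_left]
    simp only [Real.norm_eq_abs, mul_one, sq_abs]
    ring
  have h0 : 0 ≤ ⨅ q : {q // q ∈ Q}, (‖r • u - q.1‖ ^ 2 + w q.1) :=
    le_ciInf fun q => add_nonneg (sq_nonneg _) (hw _ q.2)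
  rw [powerDist, Real.sq_sqrt h0]
  constructor
  · refine le_ciInf fun q => ?_
    rw [hexp]
    have h1 := mul_le_mul_of_nonneg_left (inner_le_supportFn q.2 u) hr
    have h2 : 0 ≤ ‖q.1‖ ^ 2 + w q.1 := add_nonneg (sq_nonneg _) (hw _ q.2)
    linarith
  · obtain ⟨q, hq, hqu⟩ := exists_inner_eq_supportFn hQ u
    refine (ciInf_le (Set.finite_range _).bddBelow (⟨q, hq⟩ : {q // q ∈ Q})).trans ?_
    rw [hexp, hqu]
    linarith [hB q hq]

/-- A distance-like function determines, through its behaviour at infinity, the support function of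
its set of sites. -/
lemma tendsto_powerDist_sub {Q : Finset (Euc d)} (hQ : Q.Nonempty) {w : Euc d → ℝ}
    (hw : ∀ q ∈ Q, 0 ≤ w q) {u : Euc d} (hu : ‖u‖ = 1) :
    Filter.Tendsto (fun r : ℝ => powerDist Q w (r • u) - r) Filter.atTop
      (nhds (-supportFn Q u)) := by
  obtain ⟨B, hB⟩ := powerDist_sq_bounds hQ hw
  set h := supportFn Q u with hh
  have hlim : Filter.Tendsto (fun r : ℝ => (|B| + h ^ 2) / (r - h)) Filter.atTop (nhds 0) :=
    Filter.Tendsto.div_atTop tendsto_const_nhds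
      (Filter.tendsto_atTop_add_const_right _ (-h) Filter.tendsto_id)
  rw [tendsto_iff_dist_tendsto_zero]
  refine squeeze_zero' (Filter.Eventually.of_forall fun _ => dist_nonneg) ?_ hlim
  filter_upwards [Filter.eventually_gt_atTop (max 0 h)] with r hr
  have hr0 : 0 < r := lt_of_le_of_lt (le_max_left _ _) hr
  have hrh : 0 < r - h := sub_pos.2 (lt_of_le_of_lt (le_max_right _ _) hr)
  obtain ⟨h1, h2⟩ := hB u hu r hr0.le
  have hD : 0 ≤ powerDist Q w (r • u) := Real.sqrt_nonneg _
  set D := powerDist Q w (r • u)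
  rw [Real.dist_eq, le_div_iff₀ hrh]
  have e : D - r - -h = D - (r - h) := by ring
  rw [e]
  -- Since `D ≥ 0`, the factor `D + (r - h)` dominates `r - h`, and the difference of squares stays
  -- bounded as `r` grows.
  calc |D - (r - h)| * (r - h) ≤ |D - (r - h)| * (D + (r - h)) := by gcongr; linarith
    _ = |D ^ 2 - (r - h) ^ 2| := by
        rw [sq_sub_sq, abs_mul, abs_of_nonneg (by linarith : 0 ≤ D + (r - h)), mul_comm]
    _ ≤ |B| + h ^ 2 := by
        rw [abs_le]
        constructor <;> nlinarith [le_abs_self B, abs_nonneg B]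

lemma abs_supportFn_sub_le {Q Q' : Finset (Euc d)} (hQ : Q.Nonempty) (hQ' : Q'.Nonempty)
    {w w' : Euc d → ℝ} (hw : ∀ q ∈ Q, 0 ≤ w q) (hw' : ∀ q ∈ Q', 0 ≤ w' q) {ε : ℝ}
    (h : ∀ x, |powerDist Q w x - powerDist Q' w' x| ≤ ε) {u : Euc d} (hu : ‖u‖ = 1) :
    |supportFn Q u - supportFn Q' u| ≤ ε := by
  have hlim := ((tendsto_powerDist_sub hQ hw hu).sub (tendsto_powerDist_sub hQ' hw' hu)).abs
  have := le_of_tendsto hlim (Filter.Eventually.of_forall fun r => by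
    simpa only [sub_sub_sub_cancel_right] using h (r • u))
  rwa [neg_sub_neg, abs_sub_comm] at this

open Classical in
/-- The barycentres of the `k`-element subsets of `S`. -/
noncomputable def barycenters (S : Finset (Euc d)) (k : ℕ) : Finset (Euc d) :=
  (S.powersetCard k).image fun T => (1 / (k : ℝ)) • ∑ p ∈ T, p

lemma barycenters_nonempty {S : Finset (Euc d)} {k : ℕ} (hk : k ≤ S.card) :
    (barycenters S k).Nonempty :=
  (Finset.powersetCard_nonempty.2 hk).image _

lemma norm_le_one_of_mem_barycenters {S : Finset (Euc d)} (hS : ∀ p ∈ S, ‖p‖ = 1) {k : ℕ}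
    (hk : 0 < k) {q : Euc d} (hq : q ∈ barycenters S k) : ‖q‖ ≤ 1 := by
  obtain ⟨T, hT, rfl⟩ := Finset.mem_image.1 hq
  obtain ⟨hTS, hTk⟩ := Finset.mem_powersetCard.1 hT
  have hk' : (0 : ℝ) < k := by exact_mod_cast hk
  have : ‖∑ p ∈ T, p‖ ≤ k := by
    refine (norm_sum_le _ _).trans ?_
    rw [Finset.sum_congr rfl fun p hp => hS p (hTS hp)]
    simp [hTk]
  rw [norm_smul, Real.norm_of_nonneg (by positivity), one_div, inv_mul_le_iff₀ hk', mul_one]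
  exact this

/-- For unit vectors with barycentre `b`, the mean of `‖x - p‖²` is `‖x - b‖² + (1 - ‖b‖²)`. Subsets
sharing a barycentre also share the weight, so the infimum descends to the image. -/
lemma kDist_eq_powerDist {S : Finset (Euc d)} (hS : ∀ p ∈ S, ‖p‖ = 1) {k : ℕ} (hk : 0 < k) :
    kDist S k = powerDist (barycenters S k) fun q => 1 - ‖q‖ ^ 2 := by
  classical
  have hk' : (0 : ℝ) < k := by exact_mod_cast hk
  funext x
  rw [kDist, powerDist, Real.mul_iInf_of_nonneg (by positivity)]
  congr 1
  let f : {T // T ∈ S.powersetCard k} → {q // q ∈ barycenters S k} := fun T =>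
    ⟨(1 / (k : ℝ)) • ∑ p ∈ T.1, p, Finset.mem_image_of_mem _ T.2⟩
  have hf : Function.Surjective f := by
    rintro ⟨q, hq⟩
    obtain ⟨T, hT, rfl⟩ := Finset.mem_image.1 hq
    exact ⟨⟨T, hT⟩, rfl⟩
  rw [← hf.iInf_comp]
  refine iInf_congr fun T => ?_
  obtain ⟨hTS, hTk⟩ := Finset.mem_powersetCard.1 T.2
  have hsum : ∑ p ∈ T.1, ‖x - p‖ ^ 2 = k * (‖x‖ ^ 2 + 1) - 2 * inner ℝ x (∑ p ∈ T.1, p) := by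
    rw [Finset.sum_congr rfl fun p hp => by
      rw [norm_sub_sq_real, hS p (hTS hp)]]
    rw [Finset.sum_add_distrib, Finset.sum_sub_distrib, ← Finset.mul_sum, ← inner_sum]
    simp only [Finset.sum_const, hTk, nsmul_eq_mul]
    ring
  simp only [f]
  rw [hsum, norm_sub_sq_real, inner_smul_right]
  field_simp
  ring

/-- `(1/N) ∑ |⟨u, p_i⟩|`, the support function of the zonotope generated by the `p_i / N`. -/
noncomputable def meanAbs {N : ℕ} (p : Fin N → sphere (0 : Euc d) 1) (u : Euc d) : ℝ :=
  (1 / (N : ℝ)) * ∑ i, |inner ℝ u (p i : Euc d)|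

/-- No two of the points are equal or antipodal. -/
def NoRepeat {N : ℕ} (p : Fin N → sphere (0 : Euc d) 1) : Prop :=
  ∀ i j, i ≠ j → (p i : Euc d) ≠ p j ∧ (p i : Euc d) ≠ -p j

lemma norm_of_mem_symmCloud {N : ℕ} {p : Fin N → sphere (0 : Euc d) 1} {x : Euc d}
    (hx : x ∈ symmCloud p) : ‖x‖ = 1 := by
  simp only [symmCloud, Finset.mem_union, Finset.mem_image, Finset.mem_univ, true_and] at hx
  rcases hx with ⟨i, rfl⟩ | ⟨i, rfl⟩
  · simp
  · simp

lemma NoRepeat.signed_injective {N : ℕ} {p : Fin N → sphere (0 : Euc d) 1} (hp : NoRepeat p)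
    (u : Euc d) : Function.Injective fun i : Fin N =>
      if 0 ≤ inner ℝ u (p i : Euc d) then (p i : Euc d) else -p i := by
  intro i j hij
  by_contra hne
  obtain ⟨h1, h2⟩ := hp i j hne
  simp only at hij
  split_ifs at hij
  · exact h1 hij
  · exact h2 hij
  · exact h2 (neg_eq_iff_eq_neg.1 hij)
  · exact h1 (neg_injective hij)

lemma le_card_symmCloud {N : ℕ} {p : Fin N → sphere (0 : Euc d) 1} (hp : NoRepeat p) :
    N ≤ (symmCloud p).card := by
  classical
  have hinj : Function.Injective fun i : Fin N => (p i : Euc d) := fun i j hij => by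
    by_contra hne
    exact (hp i j hne).1 hij
  calc N = (Finset.univ.image fun i : Fin N => (p i : Euc d)).card := by
        rw [Finset.card_image_of_injective _ hinj, Finset.card_univ, Fintype.card_fin]
    _ ≤ _ := Finset.card_le_card (by
        intro x hx
        simp only [symmCloud, Finset.mem_union]
        left
        convert hx)

/-- Upper bound: a subset of `S` collects at most all positive parts, and the pair `±p_i`
contributes `|⟨u, p_i⟩|`. Equality: take from each pair the point with nonnegative product;
`NoRepeat` makes these `N` distinct points. -/
lemma supportFn_barycenters {N : ℕ} (hN : 0 < N) {p : Fin N → sphere (0 : Euc d) 1}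
    (hp : NoRepeat p) (u : Euc d) :
    supportFn (barycenters (symmCloud p) N) u = meanAbs p u := by
  classical
  have hN' : (0 : ℝ) < N := by exact_mod_cast hN
  apply le_antisymm
  · obtain ⟨q, hq, hqu⟩ := exists_inner_eq_supportFn (barycenters_nonempty (le_card_symmCloud hp)) u
    obtain ⟨T, hT, rfl⟩ := Finset.mem_image.1 hq
    obtain ⟨hTS, -⟩ := Finset.mem_powersetCard.1 hT
    rw [← hqu, inner_smul_right, meanAbs, inner_sum]
    refine mul_le_mul_of_nonneg_left ?_ (by positivity)
    have hpos : ∀ x : Euc d, 0 ≤ max (inner ℝ u x) 0 := fun x => le_max_right _ _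
    have himage : ∀ f : Fin N → Euc d, ∑ x ∈ Finset.univ.image f, max (inner ℝ u x) 0 ≤
        ∑ i, max (inner ℝ u (f i)) 0 := fun f =>
      Finset.sum_image_le_of_nonneg (g := f) (fun x _ => hpos x)
    calc ∑ x ∈ T, inner ℝ u x ≤ ∑ x ∈ T, max (inner ℝ u x) 0 :=
          Finset.sum_le_sum fun x _ => le_max_left _ _
      _ ≤ ∑ x ∈ symmCloud p, max (inner ℝ u x) 0 :=
          Finset.sum_le_sum_of_subset_of_nonneg hTS fun x _ _ => hpos x
      _ ≤ ∑ x ∈ Finset.univ.image (fun i => (p i : Euc d)), max (inner ℝ u x) 0 +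
            ∑ x ∈ Finset.univ.image (fun i => -(p i : Euc d)), max (inner ℝ u x) 0 := by
          have := Finset.sum_union_inter (f := fun x : Euc d => max (inner ℝ u x) 0)
            (s₁ := Finset.univ.image (fun i => (p i : Euc d)))
            (s₂ := Finset.univ.image (fun i => -(p i : Euc d)))
          rw [← this]
          have h0 : 0 ≤ ∑ x ∈ Finset.univ.image (fun i => (p i : Euc d)) ∩
            Finset.univ.image (fun i => -(p i : Euc d)), max (inner ℝ u x) 0 :=
              Finset.sum_nonneg fun x _ => hpos x
          refine le_of_eq_of_le ?_ (le_add_of_nonneg_right h0)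
          rw [symmCloud]
      _ ≤ ∑ i, max (inner ℝ u (p i : Euc d)) 0 + ∑ i, max (inner ℝ u (-(p i : Euc d))) 0 :=
          add_le_add (himage _) (himage _)
      _ = ∑ i, |inner ℝ u (p i : Euc d)| := by
          rw [← Finset.sum_add_distrib]
          refine Finset.sum_congr rfl fun i _ => ?_
          rw [inner_neg_right]
          rcases le_total 0 (inner ℝ u (p i : Euc d) : ℝ) with h | h
          · rw [max_eq_left h, max_eq_right (by linarith), abs_of_nonneg h, add_zero]
          · rw [max_eq_right h, max_eq_left (by linarith), abs_of_nonpos h, zero_add]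
  · let s : Fin N → Euc d := fun i => if 0 ≤ inner ℝ u (p i : Euc d) then (p i : Euc d) else -p i
    have hs : Function.Injective s := hp.signed_injective u
    have hmem : (1 / (N : ℝ)) • ∑ x ∈ Finset.univ.image s, x ∈ barycenters (symmCloud p) N := by
      refine Finset.mem_image_of_mem (fun T : Finset (Euc d) => (1 / (N : ℝ)) • ∑ x ∈ T, x) ?_
      rw [Finset.mem_powersetCard, Finset.card_image_of_injective _ hs]
      refine ⟨fun x hx => ?_, by simp⟩
      obtain ⟨i, -, rfl⟩ := Finset.mem_image.1 hx
      simp only [symmCloud, Finset.mem_union, Finset.mem_image, Finset.mem_univ, true_and, s]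
      split_ifs
      · exact Or.inl ⟨i, rfl⟩
      · exact Or.inr ⟨i, rfl⟩
    refine le_of_eq_of_le ?_ (inner_le_supportFn hmem u)
    rw [inner_smul_right, meanAbs, Finset.sum_image fun i _ j _ h => hs h, inner_sum]
    congr 1
    refine Finset.sum_congr rfl fun i _ => ?_
    simp only [s]
    split_ifs with h
    · exact abs_of_nonneg h
    · rw [inner_neg_right, abs_of_neg (not_le.1 h)]

/-- The `ε`-complexity of the `N`-distance to the symmetrized cloud is realized by a finite set
whose support function is `ε`-close to `meanAbs p` on the unit sphere. -/
lemma exists_sites_of_epsComplexity {N : ℕ} (hN : 0 < N) {p : Fin N → sphere (0 : Euc d) 1}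
    (hp : NoRepeat p) {ε : ℝ} (hε : 0 ≤ ε) :
    ∃ Q : Finset (Euc d), Q.Nonempty ∧ Q.card = epsComplexity (kDist (symmCloud p) N) ε ∧
      ∀ u : Euc d, ‖u‖ = 1 → |meanAbs p u - supportFn Q u| ≤ ε := by
  have hS : ∀ x ∈ symmCloud p, ‖x‖ = 1 := fun x hx => norm_of_mem_symmCloud hx
  have hB := barycenters_nonempty (le_card_symmCloud hp)
  have hw : ∀ q ∈ barycenters (symmCloud p) N, 0 ≤ 1 - ‖q‖ ^ 2 := fun q hq => by
    have := norm_le_one_of_mem_barycenters hS hN hq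
    nlinarith [norm_nonneg q]
  -- The infimum of an empty set of naturals would be `0`; the function approximates itself, so the
  -- infimum is attained.
  have hne : {n : ℕ | ApproxBySites (kDist (symmCloud p) N) ε n}.Nonempty :=
    ⟨_, barycenters (symmCloud p) N, fun q => 1 - ‖q‖ ^ 2, hB, hw, rfl, fun x => by
      rw [kDist_eq_powerDist hS hN, sub_self, abs_zero]
      exact hε⟩
  obtain ⟨Q, w, hQ, hwQ, hcard, happ⟩ := Nat.sInf_mem hne
  refine ⟨Q, hQ, hcard, fun u hu => ?_⟩
  rw [← supportFn_barycenters hN hp]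
  refine abs_supportFn_sub_le hB hQ hw hwQ (fun x => ?_) hu
  rw [← kDist_eq_powerDist hS hN]
  exact happ x

end Sites

/-! ### Rotation invariance, exponential moments and the size of `m_d`. -/

section UniformSphere

open scoped Pointwise

variable {d : ℕ}

lemma isProbabilityMeasure_uniformSphere (hd : 1 ≤ d) :
    IsProbabilityMeasure (uniformSphere d) := by
  have : Nonempty (Fin d) := ⟨⟨0, hd⟩⟩
  constructor
  rw [uniformSphere, Measure.smul_apply, smul_eq_mul]
  refine ENNReal.inv_mul_cancel ?_ (measure_ne_top _ _)
  rw [Ne, Measure.measure_univ_eq_zero]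
  exact Measure.toSphere_ne_zero _

instance [NeZero d] : IsProbabilityMeasure (uniformSphere d) :=
  isProbabilityMeasure_uniformSphere NeZero.one_le

/-- The self-map of the unit sphere induced by a linear isometry. -/
noncomputable def sphereMap (L : Euc d ≃ₗᵢ[ℝ] Euc d) (x : sphere (0 : Euc d) 1) :
    sphere (0 : Euc d) 1 :=
  ⟨L x, by simp⟩

lemma continuous_sphereMap (L : Euc d ≃ₗᵢ[ℝ] Euc d) : Continuous (sphereMap L) :=
  (L.continuous.comp continuous_subtype_val).subtype_mk _

lemma toSphere_preimage_sphereMap (L : Euc d ≃ₗᵢ[ℝ] Euc d) {s : Set (sphere (0 : Euc d) 1)}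
    (hs : MeasurableSet s) :
    (volume : Measure (Euc d)).toSphere (sphereMap L ⁻¹' s) =
      (volume : Measure (Euc d)).toSphere s := by
  rw [Measure.toSphere_apply' _ hs,
    Measure.toSphere_apply' _ ((continuous_sphereMap L).measurable hs)]
  congr 1
  have hL : volume (L ⁻¹' (Set.Ioo (0 : ℝ) 1 • (Subtype.val '' s : Set (Euc d)))) =
      volume (Set.Ioo (0 : ℝ) 1 • (Subtype.val '' s : Set (Euc d))) :=
    L.measurePreserving.measure_preimage_equiv (f := L.toMeasurableEquiv) _
  rw [← hL]
  congr 1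
  ext x
  simp only [Set.mem_smul, Set.mem_image, Set.mem_preimage]
  constructor
  · rintro ⟨r, hr, -, ⟨y, hy, rfl⟩, rfl⟩
    exact ⟨r, hr, _, ⟨_, hy, rfl⟩, (L.map_smul r y).symm⟩
  · rintro ⟨r, hr, -, ⟨y, hy, rfl⟩, hxy⟩
    refine ⟨r, hr, _, ⟨sphereMap L.symm y, ?_, rfl⟩, ?_⟩
    · convert hy
      exact Subtype.ext (L.apply_symm_apply _)
    · apply L.injective
      rw [L.map_smul]
      simpa [sphereMap] using hxy

lemma map_sphereMap_uniformSphere (L : Euc d ≃ₗᵢ[ℝ] Euc d) :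
    (uniformSphere d).map (sphereMap L) = uniformSphere d := by
  ext s hs
  rw [Measure.map_apply (continuous_sphereMap L).measurable hs, uniformSphere, Measure.smul_apply,
    Measure.smul_apply, toSphere_preimage_sphereMap L hs]

lemma integral_comp_isometry (L : Euc d ≃ₗᵢ[ℝ] Euc d) {f : Euc d → ℝ} (hf : Continuous f) :
    ∫ x, f (L x) ∂(uniformSphere d) = ∫ x, f x ∂(uniformSphere d) := by
  conv_rhs => rw [← map_sphereMap_uniformSphere L]
  exact (integral_map (continuous_sphereMap L).aemeasurable
    (hf.comp continuous_subtype_val).aestronglyMeasurable).symm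

lemma exists_isometry_map_eq {u v : Euc d} (h : ‖u‖ = ‖v‖) : ∃ L : Euc d ≃ₗᵢ[ℝ] Euc d, L u = v :=
  ⟨_, Submodule.reflection_sub h⟩

/-- Rotation invariance: the law of `⟨x, v⟩` depends on `‖v‖` only. -/
lemma integral_inner_eq {u v : Euc d} (h : ‖u‖ = ‖v‖) {f : ℝ → ℝ} (hf : Continuous f) :
    ∫ x, f (inner ℝ (x : Euc d) u) ∂(uniformSphere d) =
      ∫ x, f (inner ℝ (x : Euc d) v) ∂(uniformSphere d) := by
  obtain ⟨L, rfl⟩ := exists_isometry_map_eq h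
  rw [← integral_comp_isometry L (f := fun x => f (inner ℝ x (L u))) (by fun_prop)]
  simp only [LinearIsometryEquiv.inner_map_map]

lemma meanAbsInner_eq {u v : Euc d} (hu : ‖u‖ = 1) (hv : ‖v‖ = 1) :
    meanAbsInner u = meanAbsInner v :=
  integral_inner_eq (hu.trans hv.symm) continuous_abs

lemma Continuous.integrable_of_compactSpace {X : Type*} [TopologicalSpace X] [CompactSpace X]
    [MeasurableSpace X] [OpensMeasurableSpace X] {μ : Measure X} [IsFiniteMeasure μ]
    {f : X → ℝ} (hf : Continuous f) : Integrable f μ :=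
  hf.integrable_of_hasCompactSupport (HasCompactSupport.of_compactSpace f)

/-- Rotate `v` to the diagonal vector with equal entries `c = ‖v‖ / √d` and average over all
coordinate sign flips. The integrand becomes `∏ cosh (c x_i) ≤ exp (c² ∑ x_i² / 2)`, which is
constant on the sphere. -/
lemma integral_exp_inner_le [NeZero d] (v : Euc d) :
    ∫ x, Real.exp (inner ℝ v (x : Euc d)) ∂(uniformSphere d) ≤
      Real.exp (‖v‖ ^ 2 / (2 * d)) := by
  have hd : (0 : ℝ) < d := by exact_mod_cast NeZero.pos d
  set c : ℝ := ‖v‖ / Real.sqrt d with hc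
  have hc2 : c ^ 2 = ‖v‖ ^ 2 / d := by rw [hc, div_pow, Real.sq_sqrt hd.le]
  have hc0 : 0 ≤ c := by positivity
  let v' : Euc d := WithLp.toLp 2 fun _ => c
  have hv' : ‖v‖ = ‖v'‖ := by
    rw [EuclideanSpace.norm_eq v']
    simp only [v', Finset.sum_const, Finset.card_univ, Fintype.card_fin, nsmul_eq_mul,
      Real.norm_eq_abs, sq_abs, hc2]
    rw [mul_div_cancel₀ _ hd.ne', Real.sqrt_sq (norm_nonneg v)]
  have hinner : ∀ x : Euc d, inner ℝ x v' = ∑ i, c * x i := fun x => by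
    rw [PiLp.inner_apply]
    simp [v']
  let I := ∫ x, Real.exp (∑ i, c * (x : Euc d) i) ∂(uniformSphere d)
  have h1 : ∫ x, Real.exp (inner ℝ v (x : Euc d)) ∂(uniformSphere d) = I := by
    simp only [real_inner_comm _ v]
    rw [integral_inner_eq hv' Real.continuous_exp]
    simp only [hinner, I]
  have hflip : ∀ ε : Fin d → Bool, I =
      ∫ x, ∏ i, Real.exp ((if ε i then 1 else -1) * (c * (x : Euc d) i)) ∂(uniformSphere d) := by
    intro ε
    let L : Euc d ≃ₗᵢ[ℝ] Euc d := LinearIsometryEquiv.piLpCongrRight 2 fun i =>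
      if ε i then LinearIsometryEquiv.refl ℝ ℝ else LinearIsometryEquiv.neg ℝ
    have hL : ∀ (x : Euc d) i, L x i = (if ε i then 1 else -1) * x i := by
      intro x i
      simp only [L, LinearIsometryEquiv.piLpCongrRight_apply]
      cases ε i <;> simp
    simp only [I]
    rw [← integral_comp_isometry L (f := fun x => Real.exp (∑ i, c * x i)) (by fun_prop)]
    refine integral_congr_ae (Filter.Eventually.of_forall fun x => ?_)
    simp only [hL, ← Real.exp_sum]
    congr 1
    exact Finset.sum_congr rfl fun i _ => by ring
  have hcont : ∀ ε : Fin d → Bool, Integrable (fun x : sphere (0 : Euc d) 1 =>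
      ∏ i, Real.exp ((if ε i then 1 else -1) * (c * (x : Euc d) i))) (uniformSphere d) := fun ε =>
    Continuous.integrable_of_compactSpace (by fun_prop)
  have hsum : (2 : ℝ) ^ d * I =
      ∫ x, ∏ i, (2 * Real.cosh (c * (x : Euc d) i)) ∂(uniformSphere d) := by
    have h2 : ∑ ε : Fin d → Bool, I = (2 : ℝ) ^ d * I := by
      simp
    rw [← h2, Finset.sum_congr rfl fun ε _ => hflip ε, ← integral_finsetSum _ fun ε _ => hcont ε]
    refine integral_congr_ae (Filter.Eventually.of_forall fun x => ?_)
    simp only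
    rw [← Fintype.piFinset_univ, ← Finset.prod_univ_sum (fun _ : Fin d => Finset.univ)
      (fun i (b : Bool) => Real.exp ((if b then 1 else -1) * (c * (x : Euc d) i)))]
    refine Finset.prod_congr rfl fun i _ => ?_
    rw [Fintype.sum_bool, Real.cosh_eq]
    simp only [if_true, Bool.false_eq_true, if_false, one_mul, neg_one_mul]
    ring
  have hle : (2 : ℝ) ^ d * I ≤ 2 ^ d * Real.exp (‖v‖ ^ 2 / (2 * d)) := by
    rw [hsum]
    have hb : ∀ x : sphere (0 : Euc d) 1, ∏ i, (2 * Real.cosh (c * (x : Euc d) i)) ≤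
        2 ^ d * Real.exp (‖v‖ ^ 2 / (2 * d)) := by
      intro x
      have hx : ∑ i, (x : Euc d) i ^ 2 = 1 := by
        have := EuclideanSpace.norm_sq_eq (x : Euc d)
        simpa using this.symm
      calc ∏ i, (2 * Real.cosh (c * (x : Euc d) i))
          ≤ ∏ i, (2 * Real.exp ((c * (x : Euc d) i) ^ 2 / 2)) := by
            refine Finset.prod_le_prod (fun i _ => ?_) fun i _ => ?_
            · have := Real.cosh_pos (c * (x : Euc d) i)
              positivity
            · gcongr
              exact Real.cosh_le_exp_half_sq _
        _ = 2 ^ d * Real.exp (‖v‖ ^ 2 / (2 * d)) := by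
            rw [Finset.prod_mul_distrib, ← Real.exp_sum]
            simp only [Finset.prod_const, Finset.card_univ, Fintype.card_fin, mul_pow]
            rw [← Finset.sum_div, ← Finset.mul_sum, hx, hc2]
            congr 2
            field_simp
    calc _ ≤ ∫ _, 2 ^ d * Real.exp (‖v‖ ^ 2 / (2 * d)) ∂(uniformSphere d) :=
          integral_mono (Continuous.integrable_of_compactSpace
            (continuous_finsetProd _ fun i _ => by
              have := Real.continuous_cosh
              fun_prop)) (integrable_const _) hb
      _ = _ := by simp
  rw [h1]
  exact le_of_mul_le_mul_left hle (by positivity)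

/-- The second moments of the coordinates sum to `1`, and a fourth-power tail controlled by
exponential moments accounts for at most `96/100` of it. The rest gives `10 √d m ≥ 4/100`. -/
lemma le_meanAbsInner [NeZero d] {u : Euc d} (hu : ‖u‖ = 1) :
    1 / (250 * Real.sqrt d) ≤ meanAbsInner u := by
  have hd : (0 : ℝ) < d := by exact_mod_cast NeZero.pos d
  have hs : 0 < Real.sqrt d := Real.sqrt_pos.2 hd
  have hs2 : Real.sqrt d ^ 2 = d := Real.sq_sqrt hd.le
  set r := Real.sqrt d with hr
  have hpt : ∀ y : ℝ, y ^ 2 ≤ 10 * |y| / r +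
      24 / (100 * d) * (Real.exp (r * y) + Real.exp (-(r * y))) := by
    intro y
    have h4 : (r * |y|) ^ 4 ≤ 24 * (Real.exp (r * y) + Real.exp (-(r * y))) := by
      have h := Real.pow_div_factorial_le_exp (r * |y|) (by positivity) 4
      have h' : Real.exp (r * |y|) ≤ Real.exp (r * y) + Real.exp (-(r * y)) := by
        rcases abs_cases y with ⟨h, -⟩ | ⟨h, -⟩ <;> rw [h]
        · exact le_add_of_nonneg_right (Real.exp_pos _).le
        · rw [mul_neg]
          exact le_add_of_nonneg_left (Real.exp_pos _).le
      have : ((4).factorial : ℝ) = 24 := by norm_num [Nat.factorial]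
      rw [this, div_le_iff₀ (by norm_num)] at h
      linarith
    -- Truncation at `10`: the linear term dominates below, the quartic one above.
    have h5 : (r * |y|) ^ 2 ≤ 10 * (r * |y|) + (r * |y|) ^ 4 / 100 := by
      set z := r * |y| with hz
      have hz0 : 0 ≤ z := by positivity
      rcases le_total z 10 with h | h
      · nlinarith [pow_nonneg hz0 4]
      · nlinarith [mul_nonneg (sq_nonneg z) (sub_nonneg.2 (by nlinarith : (100 : ℝ) ≤ z ^ 2))]
    have h6 : d * y ^ 2 ≤ d * (10 * |y| / r +
        24 / (100 * d) * (Real.exp (r * y) + Real.exp (-(r * y)))) := by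
      have e1 : (d : ℝ) * y ^ 2 = (r * |y|) ^ 2 := by rw [mul_pow, hs2, sq_abs]
      have e2 : d * (10 * |y| / r + 24 / (100 * d) * (Real.exp (r * y) + Real.exp (-(r * y)))) =
          10 * (r * |y|) + 24 * (Real.exp (r * y) + Real.exp (-(r * y))) / 100 := by
        rw [← hs2]
        field_simp
      rw [e1, e2]
      linarith
    exact le_of_mul_le_mul_left h6 hd
  let σ := uniformSphere d
  let e : Fin d → Euc d := fun i => EuclideanSpace.single i 1
  have hne : ∀ i, ‖e i‖ = 1 := fun i => by simp [e]
  have hie : ∀ (x : Euc d) i, inner ℝ (e i) x = x i := fun x i => by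
    simp [e, EuclideanSpace.inner_single_left]
  have hexp : ∀ (i : Fin d) (s : ℝ), s ^ 2 = d →
      ∫ x, Real.exp (s * (x : Euc d) i) ∂σ ≤ 2 := by
    intro i s hsd
    have h := integral_exp_inner_le (s • e i)
    simp only [real_inner_smul_left, hie, norm_smul, hne, mul_one, Real.norm_eq_abs, sq_abs,
      hsd] at h
    refine h.trans ?_
    have h1 : (d : ℝ) / (2 * d) = 1 / 2 := by field_simp
    have h2 : Real.exp (1 / 2) ^ 2 ≤ 2 ^ 2 := by
      rw [← Real.exp_nat_mul]
      norm_num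
      linarith [Real.exp_one_lt_d9]
    rw [h1]
    exact le_of_sq_le_sq h2 (by norm_num)
  have hi1 : ∀ i : Fin d, Integrable (fun x : sphere (0 : Euc d) 1 => 10 * |(x : Euc d) i| / r) σ :=
    fun i => Continuous.integrable_of_compactSpace (by fun_prop)
  have hi2 : ∀ i : Fin d, Integrable (fun x : sphere (0 : Euc d) 1 =>
      Real.exp (r * (x : Euc d) i)) σ :=
    fun i => Continuous.integrable_of_compactSpace (by fun_prop)
  have hi3 : ∀ i : Fin d, Integrable (fun x : sphere (0 : Euc d) 1 =>
      Real.exp (-(r * (x : Euc d) i))) σ :=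
    fun i => Continuous.integrable_of_compactSpace (by fun_prop)
  have hcoord : ∀ i : Fin d, ∫ x, (x : Euc d) i ^ 2 ∂σ ≤
      10 * meanAbsInner u / r + 96 / (100 * d) := by
    intro i
    calc ∫ x, (x : Euc d) i ^ 2 ∂σ
        ≤ ∫ x, (10 * |(x : Euc d) i| / r + 24 / (100 * d) *
            (Real.exp (r * (x : Euc d) i) + Real.exp (-(r * (x : Euc d) i)))) ∂σ :=
          integral_mono (Continuous.integrable_of_compactSpace (by fun_prop))
            ((hi1 i).add (((hi2 i).add (hi3 i)).const_mul _)) fun x => hpt _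
      _ = 10 * meanAbsInner u / r + 24 / (100 * d) * (∫ x, Real.exp (r * (x : Euc d) i) ∂σ +
            ∫ x, Real.exp (-(r * (x : Euc d) i)) ∂σ) := by
          have hi4 : Integrable (fun x : sphere (0 : Euc d) 1 => 24 / (100 * (d : ℝ)) *
              (Real.exp (r * (x : Euc d) i) + Real.exp (-(r * (x : Euc d) i)))) σ :=
            ((hi2 i).add (hi3 i)).const_mul _
          rw [integral_add (hi1 i) hi4, integral_const_mul,
            integral_add (hi2 i) (hi3 i), integral_div, integral_const_mul,
            meanAbsInner_eq hu (hne i), meanAbsInner]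
          simp only [real_inner_comm (e i), hie]
          rfl
      _ ≤ 10 * meanAbsInner u / r + 24 / (100 * d) * (2 + 2) := by
          gcongr
          · exact hexp i r hs2
          · have := hexp i (-r) (by rw [neg_sq, hs2])
            simpa only [neg_mul] using this
      _ = _ := by ring
  have htot : ∑ i : Fin d, ∫ x, (x : Euc d) i ^ 2 ∂σ = 1 := by
    rw [← integral_finsetSum _ fun i _ => Continuous.integrable_of_compactSpace (by fun_prop)]
    have : ∀ x : sphere (0 : Euc d) 1, ∑ i, (x : Euc d) i ^ 2 = 1 := fun x => by
      have := EuclideanSpace.norm_sq_eq (x : Euc d)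
      simpa using this.symm
    simp [this, σ]
  have hfin : (1 : ℝ) ≤ d * (10 * meanAbsInner u / r + 96 / (100 * d)) := by
    rw [← htot]
    refine (Finset.sum_le_sum fun i _ => hcoord i).trans ?_
    rw [Finset.sum_const, Finset.card_univ, Fintype.card_fin, nsmul_eq_mul]
  have e3 : (d : ℝ) * (10 * meanAbsInner u / r + 96 / (100 * d)) =
      10 * (r * meanAbsInner u) + 96 / 100 := by
    rw [← hs2]
    field_simp
  rw [div_le_iff₀ (by positivity)]
  nlinarith

/-- The cone over a point lies in a line, which is null when `d ≥ 2`. -/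
lemma uniformSphere_singleton (hd : 2 ≤ d) (q : sphere (0 : Euc d) 1) :
    uniformSphere d {q} = 0 := by
  rw [uniformSphere, Measure.smul_apply, Measure.toSphere_apply' _ (measurableSet_singleton q)]
  have hspan : Submodule.span ℝ {(q : Euc d)} ≠ ⊤ := by
    intro h
    have h1 := finrank_span_singleton (K := ℝ) (v := (q : Euc d)) (by
      intro h0
      have := norm_eq_of_mem_sphere q
      rw [h0, norm_zero] at this
      exact zero_ne_one this)
    rw [h, finrank_top, finrank_euclideanSpace, Fintype.card_fin] at h1
    omega
  have h0 : volume (Set.Ioo (0 : ℝ) 1 • (Subtype.val '' {q} : Set (Euc d))) = 0 := by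
    refine measure_mono_null ?_ (Measure.addHaar_submodule volume _ hspan)
    rintro - ⟨r, -, -, ⟨y, rfl, rfl⟩, rfl⟩
    exact Submodule.smul_mem _ _ (Submodule.mem_span_singleton_self _)
  rw [h0]
  simp

lemma integral_meanAbs {N : ℕ} (hN : 0 < N) (p : Fin N → sphere (0 : Euc d) 1) [NeZero d]
    {u : Euc d} (hu : ‖u‖ = 1) :
    ∫ x, meanAbs p x ∂(uniformSphere d) = meanAbsInner u := by
  have hN' : (0 : ℝ) < N := by exact_mod_cast hN
  simp only [meanAbs]
  rw [integral_const_mul, integral_finsetSum _ fun i _ =>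
    Continuous.integrable_of_compactSpace (by fun_prop)]
  have : ∀ i, ∫ x, |inner ℝ (x : Euc d) (p i : Euc d)| ∂(uniformSphere d) = meanAbsInner u :=
    fun i => meanAbsInner_eq (by simp) hu
  simp only [this, Finset.sum_const, Finset.card_univ, Fintype.card_fin, nsmul_eq_mul]
  field_simp

end UniformSphere

/-! ### Symmetrization, contraction and the exponential moment of a random walk. -/

section Deviation

variable {d : ℕ}

section Compact

variable {X Y : Type*} [TopologicalSpace X] [CompactSpace X] [MeasurableSpace X]
  [OpensMeasurableSpace X] [SecondCountableTopology X]
  [TopologicalSpace Y] [CompactSpace Y] [MeasurableSpace Y] [OpensMeasurableSpace Y]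
  [SecondCountableTopology Y]

lemma integral_prod_mono_of_continuous {μ : Measure X} {ν : Measure Y} [IsFiniteMeasure μ]
    [IsFiniteMeasure ν] {f g : X × Y → ℝ} (hf : Continuous f) (hg : Continuous g)
    (h : ∀ x, ∫ y, f (x, y) ∂ν ≤ ∫ y, g (x, y) ∂ν) :
    ∫ z, f z ∂(μ.prod ν) ≤ ∫ z, g z ∂(μ.prod ν) := by
  have hf' : Integrable f (μ.prod ν) := Continuous.integrable_of_compactSpace hf
  have hg' : Integrable g (μ.prod ν) := Continuous.integrable_of_compactSpace hg
  rw [integral_prod _ hf', integral_prod _ hg']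
  exact integral_mono hf'.integral_prod_left hg'.integral_prod_left h

lemma integral_prod_mono_of_continuous' {μ : Measure X} {ν : Measure Y} [IsFiniteMeasure μ]
    [IsFiniteMeasure ν] {f g : X × Y → ℝ} (hf : Continuous f) (hg : Continuous g)
    (h : ∀ y, ∫ x, f (x, y) ∂μ ≤ ∫ x, g (x, y) ∂μ) :
    ∫ z, f z ∂(μ.prod ν) ≤ ∫ z, g z ∂(μ.prod ν) := by
  rw [← integral_prod_swap f, ← integral_prod_swap g]
  exact integral_prod_mono_of_continuous (hf.comp continuous_swap) (hg.comp continuous_swap) h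

end Compact

lemma integral_pi_succ {X : Type*} [MeasurableSpace X] (μ : Measure X) [SigmaFinite μ]
    {k : ℕ} (f : (Fin (k + 1) → X) → ℝ) :
    ∫ x, f x ∂(Measure.pi fun _ => μ) =
      ∫ z : X × (Fin k → X), f (Fin.cons z.1 z.2) ∂(μ.prod (Measure.pi fun _ => μ)) := by
  rw [← ((measurePreserving_piFinSuccAbove (fun _ : Fin (k + 1) => μ) 0).symm).integral_comp']
  simp [MeasurableEquiv.piFinSuccAbove_symm_apply, Fin.insertNthEquiv]

variable {T : Finset (Euc d)}

lemma continuous_exp_sup' {X : Type*} [TopologicalSpace X] (hT : T.Nonempty) {f : Euc d → X → ℝ}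
    (hf : ∀ t, Continuous (f t)) :
    Continuous fun x => Real.exp (T.sup' hT fun t => f t x) :=
  Real.continuous_exp.comp (Continuous.finset_sup'_apply hT fun t _ => hf t)

/-- The contraction step. With `A`, `B` the two suprema on the right, the supremum with `+|c y t|`
is at most `max A B` and the one with `-|c y t|` at most `min A B`. For negative `c` the two left
terms trade roles. -/
lemma exp_sup'_add_exp_sup'_le (hT : T.Nonempty) (a y : Euc d → ℝ) (c : ℝ) :
    Real.exp (T.sup' hT fun t => a t + c * |y t|) +
        Real.exp (T.sup' hT fun t => a t - c * |y t|) ≤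
      Real.exp (T.sup' hT fun t => a t + c * y t) +
        Real.exp (T.sup' hT fun t => a t - c * y t) := by
  set A := T.sup' hT fun t => a t + c * y t with hA
  set B := T.sup' hT fun t => a t - c * y t with hB
  have hAt : ∀ t ∈ T, a t + c * y t ≤ A := fun t ht =>
    Finset.le_sup' (fun t => a t + c * y t) ht
  have hBt : ∀ t ∈ T, a t - c * y t ≤ B := fun t ht =>
    Finset.le_sup' (fun t => a t - c * y t) ht
  have hmin : ∀ t ∈ T, a t - |c * y t| ≤ min A B := fun t ht =>
    le_min (by linarith [neg_abs_le (c * y t), hAt t ht])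
      (by linarith [le_abs_self (c * y t), hBt t ht])
  have hmax : ∀ t ∈ T, a t + |c * y t| ≤ max A B := fun t ht => by
    rcases abs_cases (c * y t) with ⟨h, -⟩ | ⟨h, -⟩ <;> rw [h]
    · exact (hAt t ht).trans (le_max_left _ _)
    · exact (hBt t ht).trans (le_max_right _ _)
  have hsum : Real.exp (max A B) + Real.exp (min A B) = Real.exp A + Real.exp B := by
    rcases le_total A B with h | h
    · rw [max_eq_right h, min_eq_left h, add_comm]
    · rw [max_eq_left h, min_eq_right h]
  rw [← hsum]
  rcases le_total 0 c with hc | hc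
  · have e : ∀ t, |c * y t| = c * |y t| := fun t => by rw [abs_mul, abs_of_nonneg hc]
    gcongr
    · exact Finset.sup'_le _ _ fun t ht => by rw [← e]; exact hmax t ht
    · exact Finset.sup'_le _ _ fun t ht => by rw [← e]; exact hmin t ht
  · have e : ∀ t, |c * y t| = -(c * |y t|) := fun t => by rw [abs_mul, abs_of_nonpos hc, neg_mul]
    rw [add_comm]
    gcongr
    · exact Finset.sup'_le _ _ fun t ht => by
        have := hmax t ht
        rw [e] at this
        linarith
    · exact Finset.sup'_le _ _ fun t ht => by
        have := hmin t ht
        rw [e] at this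
        linarith

lemma exp_integral_le {X : Type*} [TopologicalSpace X] [CompactSpace X] [MeasurableSpace X]
    [OpensMeasurableSpace X] {μ : Measure X} [IsProbabilityMeasure μ] {f : X → ℝ}
    (hf : Continuous f) : Real.exp (∫ x, f x ∂μ) ≤ ∫ x, Real.exp (f x) ∂μ :=
  convexOn_exp.map_integral_le Real.continuous_exp.continuousOn isClosed_univ
    (Filter.Eventually.of_forall fun _ => Set.mem_univ _)
    (Continuous.integrable_of_compactSpace hf)
    (Continuous.integrable_of_compactSpace (Real.continuous_exp.comp hf))

/-- Symmetrization and contraction for a single random direction: the centred absolute values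
`|⟨t, x⟩| - m` may be replaced by `2 ⟨t, x⟩` in an exponential moment of a maximum. -/
lemma integral_exp_sup'_abs_le [NeZero d] (hT : T.Nonempty) {m : ℝ}
    (hm : ∀ t ∈ T, meanAbsInner t = m) (a : Euc d → ℝ) (c : ℝ) :
    ∫ x, Real.exp (T.sup' hT fun t => a t + c * (|inner ℝ t (x : Euc d)| - m))
        ∂(uniformSphere d) ≤
      ∫ x, Real.exp (T.sup' hT fun t => a t + 2 * c * inner ℝ t (x : Euc d))
        ∂(uniformSphere d) := by
  let σ := uniformSphere d
  let G : sphere (0 : Euc d) 1 → ℝ := fun x =>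
    Real.exp (T.sup' hT fun t => a t + 2 * c * |inner ℝ t (x : Euc d)|)
  let H : sphere (0 : Euc d) 1 → ℝ := fun x =>
    Real.exp (T.sup' hT fun t => a t - 2 * c * |inner ℝ t (x : Euc d)|)
  let K : Euc d → ℝ := fun x => Real.exp (T.sup' hT fun t => a t + 2 * c * inner ℝ t x)
  have hGc : Continuous G := continuous_exp_sup' hT fun t => by fun_prop
  have hHc : Continuous H := continuous_exp_sup' hT fun t => by fun_prop
  have hKc : Continuous K := continuous_exp_sup' hT fun t => by fun_prop
  have hG : Integrable G σ := Continuous.integrable_of_compactSpace hGc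
  have hH : Integrable H σ := Continuous.integrable_of_compactSpace hHc
  have hpt : ∀ x y : sphere (0 : Euc d) 1, ∀ t ∈ T,
      Real.exp (a t + c * |inner ℝ t (x : Euc d)| - c * |inner ℝ t (y : Euc d)|) ≤
        1 / 2 * G x + 1 / 2 * H y := by
    intro x y t ht
    have h1 := convexOn_exp.2 (Set.mem_univ (a t + 2 * c * |inner ℝ t (x : Euc d)|))
      (Set.mem_univ (a t - 2 * c * |inner ℝ t (y : Euc d)|)) (by norm_num : (0 : ℝ) ≤ 1 / 2)
      (by norm_num : (0 : ℝ) ≤ 1 / 2) (by norm_num)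
    simp only [smul_eq_mul] at h1
    have e : a t + c * |inner ℝ t (x : Euc d)| - c * |inner ℝ t (y : Euc d)| =
        1 / 2 * (a t + 2 * c * |inner ℝ t (x : Euc d)|) +
          1 / 2 * (a t - 2 * c * |inner ℝ t (y : Euc d)|) := by ring
    rw [e]
    refine h1.trans ?_
    gcongr
    · exact Real.exp_le_exp.2
        (Finset.le_sup' (fun t => a t + 2 * c * |inner ℝ t (x : Euc d)|) ht)
    · exact Real.exp_le_exp.2
        (Finset.le_sup' (fun t => a t - 2 * c * |inner ℝ t (y : Euc d)|) ht)
  have hjensen : ∀ x : sphere (0 : Euc d) 1,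
      Real.exp (T.sup' hT fun t => a t + c * (|inner ℝ t (x : Euc d)| - m)) ≤
        1 / 2 * G x + 1 / 2 * ∫ y, H y ∂σ := by
    intro x
    -- At a maximizing `t`, write `m` as the mean of `|⟨t, y⟩|` over an independent copy `y` and
    -- apply Jensen's inequality. Convexity then separates `x` from `y` at the price of doubling
    -- `c`.
    obtain ⟨t, ht, hmax⟩ := Finset.exists_mem_eq_sup' hT
      (fun t => a t + c * (|inner ℝ t (x : Euc d)| - m))
    rw [hmax]
    have e : a t + c * (|inner ℝ t (x : Euc d)| - m) =
        ∫ y, (a t + c * |inner ℝ t (x : Euc d)| - c * |inner ℝ t (y : Euc d)|) ∂σ := by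
      rw [integral_sub (integrable_const _) (Continuous.integrable_of_compactSpace (by fun_prop)),
        integral_const_mul, ← hm t ht, meanAbsInner]
      simp only [integral_const, probReal_univ, one_smul, real_inner_comm t, σ]
      ring
    rw [e]
    refine (exp_integral_le (by fun_prop)).trans ?_
    have e2 : 1 / 2 * G x + 1 / 2 * ∫ y, H y ∂σ = ∫ y, (1 / 2 * G x + 1 / 2 * H y) ∂σ := by
      rw [integral_add (integrable_const _) (hH.const_mul _), integral_const_mul _ H]
      simp only [integral_const, probReal_univ, one_smul]
    rw [e2]
    exact integral_mono (Continuous.integrable_of_compactSpace (by fun_prop))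
      ((integrable_const _).add (hH.const_mul _)) fun y => hpt x y t ht
  have hneg : ∫ x, K (-(x : Euc d)) ∂σ = ∫ x, K (x : Euc d) ∂σ :=
    integral_comp_isometry (LinearIsometryEquiv.neg ℝ) hKc
  have hK1 : Integrable (fun x : sphere (0 : Euc d) 1 => K (x : Euc d)) σ :=
    Continuous.integrable_of_compactSpace (by fun_prop)
  have hK2 : Integrable (fun x : sphere (0 : Euc d) 1 => K (-(x : Euc d))) σ :=
    Continuous.integrable_of_compactSpace (by fun_prop)
  have hGH : ∫ x, G x ∂σ + ∫ x, H x ∂σ ≤ 2 * ∫ x, K (x : Euc d) ∂σ := by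
    rw [two_mul]
    nth_rewrite 2 [← hneg]
    rw [← integral_add hG hH, ← integral_add hK1 hK2]
    refine integral_mono (hG.add hH) (hK1.add hK2) fun x => ?_
    have := exp_sup'_add_exp_sup'_le hT a (fun t => inner ℝ t (x : Euc d)) (2 * c)
    simpa only [G, H, K, inner_neg_right, mul_neg, ← sub_eq_add_neg] using this
  calc _ ≤ ∫ x, (1 / 2 * G x + 1 / 2 * ∫ y, H y ∂σ) ∂σ :=
        integral_mono (Continuous.integrable_of_compactSpace
          (continuous_exp_sup' hT fun t => by fun_prop))
          ((hG.const_mul _).add (integrable_const _)) hjensen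
    _ = 1 / 2 * (∫ x, G x ∂σ + ∫ x, H x ∂σ) := by
        rw [integral_add (hG.const_mul _) (integrable_const _), integral_const_mul]
        simp only [integral_const, probReal_univ, one_smul]
        ring
    _ ≤ ∫ x, K (x : Euc d) ∂σ := by linarith

/-- The points are replaced one at a time: with the others fixed, their contribution is part of the
offset. This is why the induction runs over arbitrary `a`. -/
lemma integral_exp_sup'_sum_abs_le [NeZero d] (hT : T.Nonempty) {m : ℝ}
    (hm : ∀ t ∈ T, meanAbsInner t = m) (c : ℝ) (k : ℕ) (a : Euc d → ℝ) :
    ∫ x : Fin k → sphere (0 : Euc d) 1,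
        Real.exp (T.sup' hT fun t => a t + ∑ i, c * (|inner ℝ t (x i : Euc d)| - m))
        ∂(Measure.pi fun _ => uniformSphere d) ≤
      ∫ x : Fin k → sphere (0 : Euc d) 1,
        Real.exp (T.sup' hT fun t => a t + ∑ i, 2 * c * inner ℝ t (x i : Euc d))
        ∂(Measure.pi fun _ => uniformSphere d) := by
  induction k generalizing a with
  | zero => simp
  | succ k ih =>
    rw [integral_pi_succ, integral_pi_succ]
    simp only [Fin.sum_univ_succ, Fin.cons_zero, Fin.cons_succ]
    have hcont1 : Continuous fun z : sphere (0 : Euc d) 1 × (Fin k → sphere (0 : Euc d) 1) =>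
        Real.exp (T.sup' hT fun t => a t + (c * (|inner ℝ t (z.1 : Euc d)| - m) +
          ∑ i, c * (|inner ℝ t (z.2 i : Euc d)| - m))) :=
      continuous_exp_sup' hT fun t => by fun_prop
    have hcont2 : Continuous fun z : sphere (0 : Euc d) 1 × (Fin k → sphere (0 : Euc d) 1) =>
        Real.exp (T.sup' hT fun t => a t + (c * (|inner ℝ t (z.1 : Euc d)| - m) +
          ∑ i, 2 * c * inner ℝ t (z.2 i : Euc d))) :=
      continuous_exp_sup' hT fun t => by fun_prop
    have hcont3 : Continuous fun z : sphere (0 : Euc d) 1 × (Fin k → sphere (0 : Euc d) 1) =>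
        Real.exp (T.sup' hT fun t => a t + (2 * c * inner ℝ t (z.1 : Euc d) +
          ∑ i, 2 * c * inner ℝ t (z.2 i : Euc d))) :=
      continuous_exp_sup' hT fun t => by fun_prop
    refine (integral_prod_mono_of_continuous hcont1 hcont2 fun x => ?_).trans
      (integral_prod_mono_of_continuous' hcont2 hcont3 fun y => ?_)
    · simpa only [add_assoc] using ih fun t => a t + c * (|inner ℝ t (x : Euc d)| - m)
    · have := integral_exp_sup'_abs_le hT hm
        (fun t => a t + ∑ i, 2 * c * inner ℝ t (y i : Euc d)) c
      simpa only [add_assoc, add_comm, add_left_comm] using this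

/-- Gaussian-type integrability of the norm of a sum of independent uniform directions. -/
lemma integral_exp_norm_sq_le [NeZero d] {N : ℕ} (hN : 0 < N) {k : ℕ} (hk : k ≤ N) (v : Euc d) :
    ∫ x : Fin k → sphere (0 : Euc d) 1,
        Real.exp (d / (8 * N) * ‖v + ∑ i, (x i : Euc d)‖ ^ 2)
        ∂(Measure.pi fun _ => uniformSphere d) ≤
      Real.exp (2 * (d / (8 * N)) * k + d / (8 * N) * (1 + k / N) * ‖v‖ ^ 2) := by
  have hd : (0 : ℝ) < d := by exact_mod_cast NeZero.pos d
  have hN' : (0 : ℝ) < N := by exact_mod_cast hN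
  set α : ℝ := d / (8 * N) with hα
  have hα0 : 0 < α := by positivity
  induction k generalizing v with
  | zero => simp
  | succ k ih =>
    have hkN : (k : ℝ) / N ≤ 1 := by
      rw [div_le_one hN']
      exact_mod_cast (Nat.le_succ k).trans hk
    have hk0 : 0 ≤ (k : ℝ) / N := by positivity
    -- Integrating out one point raises the coefficient of `‖v‖²` from `β` to at most `β + α / N`.
    -- It stays at most `2α` for `k ≤ N`, so each step costs at most `2α` in the constant term.
    set β : ℝ := α * (1 + k / N) with hβ
    have hβα : β ≤ 2 * α := by nlinarith
    have hβ0 : 0 ≤ β := by positivity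
    rw [integral_pi_succ]
    simp only [Fin.sum_univ_succ, Fin.cons_zero, Fin.cons_succ]
    have hint : Integrable (fun z : sphere (0 : Euc d) 1 × (Fin k → sphere (0 : Euc d) 1) =>
        Real.exp (α * ‖v + ((z.1 : Euc d) + ∑ i, (z.2 i : Euc d))‖ ^ 2))
        ((uniformSphere d).prod (Measure.pi fun _ => uniformSphere d)) :=
      Continuous.integrable_of_compactSpace (by fun_prop)
    rw [integral_prod _ hint]
    calc _ ≤ ∫ x : sphere (0 : Euc d) 1, Real.exp (2 * α * k + β * (‖v‖ ^ 2 + 1)) *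
          Real.exp (inner ℝ ((2 * β) • v) (x : Euc d)) ∂(uniformSphere d) := by
          refine integral_mono hint.integral_prod_left
            (Continuous.integrable_of_compactSpace (by fun_prop)) fun x => ?_
          have h := ih ((Nat.le_succ k).trans hk) (v + x)
          simp only [add_assoc] at h
          refine h.trans (le_of_eq ?_)
          rw [← Real.exp_add, norm_add_sq_real, norm_eq_of_mem_sphere, real_inner_smul_left, hβ]
          congr 1
          ring
      _ ≤ Real.exp (2 * α * k + β * (‖v‖ ^ 2 + 1)) *
            Real.exp (‖(2 * β) • v‖ ^ 2 / (2 * d)) := by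
          rw [integral_const_mul]
          gcongr
          exact integral_exp_inner_le _
      _ ≤ _ := by
          rw [← Real.exp_add]
          apply Real.exp_le_exp.2
          rw [norm_smul, mul_pow, Real.norm_of_nonneg (by positivity : 0 ≤ 2 * β)]
          have h1 : (2 * β) ^ 2 * ‖v‖ ^ 2 / (2 * d) ≤ α / N * ‖v‖ ^ 2 := by
            have : (2 * β) ^ 2 / (2 * d) ≤ α / N := by
              -- The choice `α = d / (8N)` makes this an equality.
              have e : α / N = (4 * α) ^ 2 / (2 * d) := by
                rw [hα]
                field_simp
                norm_num
              rw [e]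
              exact div_le_div_of_nonneg_right
                (pow_le_pow_left₀ (by positivity) (by linarith) 2) (by positivity)
            calc _ = (2 * β) ^ 2 / (2 * d) * ‖v‖ ^ 2 := by ring
              _ ≤ _ := by gcongr
          push_cast
          have e2 : α * (1 + ((k : ℝ) + 1) / N) = β + α / N := by
            rw [hβ]
            ring
          rw [e2]
          nlinarith

end Deviation

/-! ### Uniform deviation of the zonotope's support function. -/

section Uniform

variable {d : ℕ} {T : Finset (Euc d)}

/-- By Cauchy–Schwarz the supremum is at most `2|c| ‖∑ x_i‖`, and completing the square reduces it
to the moment of `‖∑ x_i‖²`. -/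
lemma integral_exp_sup'_sum_inner_le [NeZero d] (hT : T.Nonempty) (hT1 : ∀ t ∈ T, ‖t‖ = 1)
    {N : ℕ} (hN : 0 < N) (c : ℝ) :
    ∫ x : Fin N → sphere (0 : Euc d) 1,
        Real.exp (T.sup' hT fun t => 0 + ∑ i, 2 * c * inner ℝ t (x i : Euc d))
        ∂(Measure.pi fun _ => uniformSphere d) ≤ Real.exp (8 * N * c ^ 2 / d + d / 4) := by
  have hd : (0 : ℝ) < d := by exact_mod_cast NeZero.pos d
  have hN' : (0 : ℝ) < N := by exact_mod_cast hN
  have hpt : ∀ x : Fin N → sphere (0 : Euc d) 1,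
      Real.exp (T.sup' hT fun t => 0 + ∑ i, 2 * c * inner ℝ t (x i : Euc d)) ≤
        Real.exp (8 * N * c ^ 2 / d) *
          Real.exp (d / (8 * N) * ‖0 + ∑ i, (x i : Euc d)‖ ^ 2) := by
    intro x
    rw [← Real.exp_add, zero_add]
    refine Real.exp_le_exp.2 (Finset.sup'_le _ _ fun t ht => ?_)
    rw [zero_add, ← Finset.mul_sum, ← inner_sum]
    set z := ‖∑ i, (x i : Euc d)‖ with hz
    have h1 : c * inner ℝ t (∑ i, (x i : Euc d)) ≤ |c| * z := by
      refine (le_abs_self _).trans ?_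
      rw [abs_mul]
      have := abs_real_inner_le_norm t (∑ i, (x i : Euc d))
      rw [hT1 t ht, one_mul] at this
      gcongr
    have h2 : 8 * N * c ^ 2 / d + d / (8 * N) * z ^ 2 - 2 * (|c| * z) =
        d / (8 * N) * (8 * N * |c| / d - z) ^ 2 := by
      rw [← sq_abs c]
      field_simp
      ring
    have h3 : 0 ≤ d / (8 * N) * (8 * N * |c| / d - z) ^ 2 := by positivity
    linarith
  calc _ ≤ ∫ x : Fin N → sphere (0 : Euc d) 1, Real.exp (8 * N * c ^ 2 / d) *
          Real.exp (d / (8 * N) * ‖0 + ∑ i, (x i : Euc d)‖ ^ 2)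
          ∂(Measure.pi fun _ => uniformSphere d) :=
        integral_mono (Continuous.integrable_of_compactSpace
          (continuous_exp_sup' hT fun t => by fun_prop))
          (Continuous.integrable_of_compactSpace (by fun_prop)) hpt
    _ ≤ Real.exp (8 * N * c ^ 2 / d) * Real.exp (d / 4) := by
        rw [integral_const_mul]
        gcongr
        refine (integral_exp_norm_sq_le hN le_rfl 0).trans (le_of_eq ?_)
        congr 1
        rw [norm_zero]
        field_simp
        ring
    _ = _ := (Real.exp_add _ _).symm

/-- Markov's inequality; `|c| = s d / 16` minimizes the exponent `8 N c² / d - |c| N s`. The bound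
does not involve `|T|`, so a net of any size may be used. The two signs of `c` give the two tails.
-/
lemma measure_sum_abs_ge_le [NeZero d] (hT1 : ∀ t ∈ T, ‖t‖ = 1) {m : ℝ}
    (hm : ∀ t ∈ T, meanAbsInner t = m) {N : ℕ} (hN : 0 < N) {s c : ℝ}
    (hc : |c| = s * d / 16) :
    (Measure.pi fun _ => uniformSphere d).real
        {x : Fin N → sphere (0 : Euc d) 1 |
          ∃ t ∈ T, |c| * (N * s) ≤ ∑ i, c * (|inner ℝ t (x i : Euc d)| - m)} ≤
      Real.exp (-(N * s ^ 2 * d / 32) + d / 4) := by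
  have hd : (0 : ℝ) < d := by exact_mod_cast NeZero.pos d
  rcases T.eq_empty_or_nonempty with rfl | hT
  · simpa using (Real.exp_pos _).le
  let F : (Fin N → sphere (0 : Euc d) 1) → ℝ := fun x =>
    Real.exp (T.sup' hT fun t => 0 + ∑ i, c * (|inner ℝ t (x i : Euc d)| - m))
  have hF : Integrable F (Measure.pi fun _ => uniformSphere d) :=
    Continuous.integrable_of_compactSpace (continuous_exp_sup' hT fun t => by fun_prop)
  have hmarkov := mul_meas_ge_le_integral_of_nonneg
    (Filter.Eventually.of_forall fun x => (Real.exp_pos _).le) hF (Real.exp (|c| * (N * s)))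
  have hint := (integral_exp_sup'_sum_abs_le hT hm c N 0).trans
    (integral_exp_sup'_sum_inner_le hT hT1 hN c)
  have hsub : (Measure.pi fun _ => uniformSphere d).real
      {x : Fin N → sphere (0 : Euc d) 1 |
        ∃ t ∈ T, |c| * (N * s) ≤ ∑ i, c * (|inner ℝ t (x i : Euc d)| - m)} ≤
      (Measure.pi fun _ => uniformSphere d).real {x | Real.exp (|c| * (N * s)) ≤ F x} := by
    refine measureReal_mono ?_
    rintro x ⟨t, ht, hx⟩
    refine Real.exp_le_exp.2 (hx.trans ?_)
    rw [← zero_add (∑ i, c * (|inner ℝ t (x i : Euc d)| - m))]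
    exact Finset.le_sup' (fun t => 0 + ∑ i, c * (|inner ℝ t (x i : Euc d)| - m)) ht
  have h2 := hmarkov.trans hint
  rw [← le_div_iff₀' (Real.exp_pos _), ← Real.exp_sub] at h2
  refine hsub.trans (h2.trans (Real.exp_le_exp.2 (le_of_eq ?_)))
  rw [← sq_abs c, hc]
  field_simp
  ring

lemma abs_meanAbs_sub_le {N : ℕ} (hN : 0 < N) (x : Fin N → sphere (0 : Euc d) 1) (u v : Euc d) :
    |meanAbs x u - meanAbs x v| ≤ ‖u - v‖ := by
  have hN' : (0 : ℝ) < N := by exact_mod_cast hN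
  rw [meanAbs, meanAbs, ← mul_sub, ← Finset.sum_sub_distrib, abs_mul,
    abs_of_pos (one_div_pos.2 hN'), one_div, inv_mul_le_iff₀ hN']
  calc |∑ i, (|inner ℝ u (x i : Euc d)| - |inner ℝ v (x i : Euc d)|)|
      ≤ ∑ i, |(|inner ℝ u (x i : Euc d)| - |inner ℝ v (x i : Euc d)|)| :=
        Finset.abs_sum_le_sum_abs _ _
    _ ≤ ∑ _i : Fin N, ‖u - v‖ := by
        refine Finset.sum_le_sum fun i _ => (abs_abs_sub_abs_le _ _).trans ?_
        rw [← inner_sub_left]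
        simpa using abs_real_inner_le_norm (u - v) (x i : Euc d)
    _ = N * ‖u - v‖ := by simp

/-- Uniform deviation: `meanAbs x` is within `2 s` of its mean on the whole sphere, outside an event
of probability `2 exp (-N s² d / 32 + d / 4)`. -/
lemma measure_exists_abs_meanAbs_sub_gt_le [NeZero d] {m : ℝ}
    (hm : ∀ t : Euc d, ‖t‖ = 1 → meanAbsInner t = m) {N : ℕ} (hN : 0 < N) {s : ℝ} (hs : 0 < s) :
    (Measure.pi fun _ => uniformSphere d).real
        {x : Fin N → sphere (0 : Euc d) 1 | ∃ u : Euc d, ‖u‖ = 1 ∧ 2 * s < |meanAbs x u - m|} ≤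
      2 * Real.exp (-(N * s ^ 2 * d / 32) + d / 4) := by
  have hd : (0 : ℝ) < d := by exact_mod_cast NeZero.pos d
  have hN' : (0 : ℝ) < N := by exact_mod_cast hN
  obtain ⟨T', hT's, hfin, hcov⟩ := (isCompact_sphere (0 : Euc d) 1).finite_cover_balls hs
  lift T' to Finset (Euc d) using hfin
  have hT1 : ∀ t ∈ T', ‖t‖ = 1 := fun t ht => mem_sphere_zero_iff_norm.1 (hT's ht)
  have hmT : ∀ t ∈ T', meanAbsInner t = m := fun t ht => hm t (hT1 t ht)
  have hsd : 0 < s * d / 16 := by positivity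
  let E : ℝ → Set (Fin N → sphere (0 : Euc d) 1) := fun c =>
    {x | ∃ t ∈ T', |c| * (N * s) ≤ ∑ i, c * (|inner ℝ t (x i : Euc d)| - m)}
  have hE : ∀ c, |c| = s * d / 16 → (Measure.pi fun _ => uniformSphere d).real (E c) ≤
      Real.exp (-(N * s ^ 2 * d / 32) + d / 4) := fun c hc =>
    measure_sum_abs_ge_le hT1 hmT hN hc
  have hsum : ∀ x : Fin N → sphere (0 : Euc d) 1, ∀ t : Euc d,
      ∑ i, (|inner ℝ t (x i : Euc d)| - m) = N * (meanAbs x t - m) := fun x t => by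
    rw [Finset.sum_sub_distrib, meanAbs]
    simp only [Finset.sum_const, Finset.card_univ, Fintype.card_fin, nsmul_eq_mul]
    field_simp
  have hsub : {x : Fin N → sphere (0 : Euc d) 1 |
      ∃ u : Euc d, ‖u‖ = 1 ∧ 2 * s < |meanAbs x u - m|} ⊆ E (s * d / 16) ∪ E (-(s * d / 16)) := by
    rintro x ⟨u, hu, hx⟩
    obtain ⟨t, ht, hut⟩ := Set.mem_iUnion₂.1 (hcov (mem_sphere_zero_iff_norm.2 hu))
    rw [mem_ball, dist_eq_norm] at hut
    -- `meanAbs x` is `1`-Lipschitz, so moving to the net costs less than `s` of the deviation `2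
    -- s`.
    have h1 : s < |meanAbs x t - m| := by
      have h2 := abs_meanAbs_sub_le hN x u t
      have h3 := abs_sub_le (meanAbs x u) (meanAbs x t) m
      linarith
    rcases lt_abs.1 h1 with h | h
    · left
      refine ⟨t, ht, ?_⟩
      rw [← Finset.mul_sum, hsum, abs_of_pos hsd]
      gcongr
    · right
      refine ⟨t, ht, ?_⟩
      rw [← Finset.mul_sum, hsum, abs_neg, abs_of_pos hsd, neg_mul, ← mul_neg, ← mul_neg]
      gcongr
  calc _ ≤ (Measure.pi fun _ => uniformSphere d).real (E (s * d / 16) ∪ E (-(s * d / 16))) :=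
        measureReal_mono hsub
    _ ≤ _ := measureReal_union_le _ _
    _ ≤ _ := by
        rw [two_mul]
        exact add_le_add (hE _ (abs_of_pos hsd)) (hE _ (by rw [abs_neg, abs_of_pos hsd]))

end Uniform

/-! ### Transfer to random points on a probability space. -/

section RandomPoints

variable {d N : ℕ} {Ω : Type*} [MeasurableSpace Ω] {μ : Measure Ω} [IsProbabilityMeasure μ]
  {p : Fin N → Ω → sphere (0 : Euc d) 1}

lemma ae_noRepeat (hd : 2 ≤ d) (hp : ∀ i, Measurable (p i)) (hind : iIndepFun p μ)
    (hlaw : ∀ i, μ.map (p i) = uniformSphere d) :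
    ∀ᵐ ω ∂μ, NoRepeat fun i => p i ω := by
  have : IsProbabilityMeasure (uniformSphere d) :=
    isProbabilityMeasure_uniformSphere (by omega)
  simp only [NoRepeat, ae_all_iff]
  intro i j hij
  have hmap := (indepFun_iff_map_prod_eq_prod_map_map (hp i).aemeasurable
    (hp j).aemeasurable).1 (hind.indepFun hij)
  rw [hlaw, hlaw] at hmap
  have hae : ∀ᵐ z ∂((uniformSphere d).prod (uniformSphere d)),
      (z.1 : Euc d) ≠ z.2 ∧ (z.1 : Euc d) ≠ -z.2 := by
    have hmeas : MeasurableSet {z : sphere (0 : Euc d) 1 × sphere (0 : Euc d) 1 |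
        (z.1 : Euc d) ≠ z.2 ∧ (z.1 : Euc d) ≠ -z.2} := by
      have h1 : IsOpen {z : sphere (0 : Euc d) 1 × sphere (0 : Euc d) 1 | (z.1 : Euc d) ≠ z.2} :=
        isOpen_ne_fun (by fun_prop) (by fun_prop)
      have h2 : IsOpen {z : sphere (0 : Euc d) 1 × sphere (0 : Euc d) 1 | (z.1 : Euc d) ≠ -z.2} :=
        isOpen_ne_fun (by fun_prop) (by fun_prop)
      exact (h1.inter h2).measurableSet
    rw [Measure.ae_prod_iff_ae_ae hmeas]
    refine Filter.Eventually.of_forall fun x => ?_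
    have hx : ∀ q : sphere (0 : Euc d) 1, ∀ᵐ y ∂(uniformSphere d), y ≠ q := fun q => by
      rw [ae_iff]
      simpa using uniformSphere_singleton hd q
    filter_upwards [hx x, hx (-x)] with y h1 h2
    refine ⟨fun h => h1 (Subtype.ext h.symm), fun h => h2 (Subtype.ext ?_)⟩
    rw [coe_neg_sphere, h, neg_neg]
  rw [← hmap] at hae
  exact ae_of_ae_map ((hp i).prodMk (hp j)).aemeasurable hae

lemma measure_exists_abs_meanAbs_sub_gt_le' [NeZero d] (hp : ∀ i, Measurable (p i))
    (hind : iIndepFun p μ) (hlaw : ∀ i, μ.map (p i) = uniformSphere d) {m : ℝ}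
    (hm : ∀ t : Euc d, ‖t‖ = 1 → meanAbsInner t = m) (hN : 0 < N) {s : ℝ} (hs : 0 < s) :
    μ.real {ω | ∃ u : Euc d, ‖u‖ = 1 ∧ 2 * s < |meanAbs (fun i => p i ω) u - m|} ≤
      2 * Real.exp (-(N * s ^ 2 * d / 32) + d / 4) := by
  have hmap := (iIndepFun_iff_map_fun_eq_pi_map fun i => (hp i).aemeasurable).1 hind
  simp only [hlaw] at hmap
  refine le_trans ?_ (measure_exists_abs_meanAbs_sub_gt_le hm hN hs)
  rw [← hmap]
  have : IsFiniteMeasure (μ.map fun ω i => p i ω) := by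
    rw [hmap]
    infer_instance
  -- This direction of the comparison with the image measure holds for arbitrary sets, so the event
  -- need not be shown measurable.
  exact ENNReal.toReal_mono (measure_ne_top _ _)
    (Measure.le_map_apply (measurable_pi_lambda _ hp).aemeasurable _)

lemma exists_measurableSet_of_measure_not_le {P : Ω → Prop} {δ : ℝ}
    (h : μ.real {ω | ¬ P ω} ≤ δ) :
    ∃ A : Set Ω, MeasurableSet A ∧ 1 - δ ≤ μ.real A ∧ ∀ ω ∈ A, P ω := by
  refine ⟨(toMeasurable μ {ω | ¬ P ω})ᶜ, (measurableSet_toMeasurable _ _).compl, ?_, fun ω hω => ?_⟩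
  · rw [probReal_compl_eq_one_sub (measurableSet_toMeasurable _ _), measureReal_def,
      measure_toMeasurable, ← measureReal_def]
    linarith
  · by_contra hP
    exact hω (subset_toMeasurable μ _ hP)

end RandomPoints

/-! ### Counting sites and numerical bounds. -/

section Complexity

variable {d N : ℕ}

lemma norm_le_of_supportFn_le {Q : Finset (Euc d)} {R : ℝ} (hR : 0 ≤ R)
    (h : ∀ u : Euc d, ‖u‖ = 1 → supportFn Q u ≤ R) : ∀ q ∈ Q, ‖q‖ ≤ R := by
  intro q hq
  rcases eq_or_ne q 0 with rfl | hq0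
  · simpa using hR
  · have hqn : ‖q‖ ≠ 0 := norm_ne_zero_iff.2 hq0
    have h1 := (inner_le_supportFn hq (‖q‖⁻¹ • q)).trans (h _ (by simp [norm_smul, hqn]))
    rw [real_inner_smul_left, real_inner_self_eq_norm_sq, sq, inv_mul_cancel_left₀ hqn] at h1
    exact h1

/-- Many points are needed for the support function to be almost constant on the unit sphere. -/
lemma one_le_card_mul_of_supportFn (hd : 1 ≤ d) {Q : Finset (Euc d)} (hQ : Q.Nonempty)
    {m τ : ℝ} (hm : 0 < m) (hτ0 : 0 < τ) (hτ : τ ≤ 1 / 3)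
    (h : ∀ u : Euc d, ‖u‖ = 1 → |supportFn Q u - m| ≤ m * τ) :
    1 ≤ Q.card * Real.sqrt (4 * τ) ^ (d - 1) := by
  have hτ1 : 0 < 1 + τ := by linarith
  have hR : 0 < m * (1 + τ) := by positivity
  -- The ratio of the smallest to the largest allowed support value; `τ ≤ 1/3` is exactly `t ≥ 1/2`.
  set t := (1 - τ) / (1 + τ) with ht
  have ht2 : 1 / 2 ≤ t := by
    rw [ht, le_div_iff₀ hτ1]
    linarith
  have ht1 : t < 1 := by
    rw [ht, div_lt_one hτ1]
    linarith
  have hmain := one_le_card_mul_of_cover hd (Q := Q) hR ht2 ht1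
    (norm_le_of_supportFn_le hR.le fun u hu => by linarith [(abs_le.1 (h u hu)).2])
    (fun u hu => by
      obtain ⟨q, hq, hqu⟩ := exists_inner_eq_supportFn hQ u
      refine ⟨q, hq, ?_⟩
      have e : t * (m * (1 + τ)) = m * (1 - τ) := by
        rw [ht]
        field_simp
      rw [hqu, e]
      linarith [(abs_le.1 (h u hu)).1])
  refine hmain.trans ?_
  have hle : 1 - t ^ 2 ≤ 4 * τ := by
    have e : 1 - t ^ 2 = 4 * τ / (1 + τ) ^ 2 := by
      rw [ht]
      field_simp
      ring
    rw [e]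
    exact div_le_self (by positivity) (by nlinarith)
  gcongr

lemma meanAbs_neg (p : Fin N → sphere (0 : Euc d) 1) (u : Euc d) :
    meanAbs p (-u) = meanAbs p u := by
  simp only [meanAbs, inner_neg_left, abs_neg]

/-- A single site is not enough as long as `η < 1`. -/
lemma two_le_card [NeZero d] (hN : 0 < N) (p : Fin N → sphere (0 : Euc d) 1) {u₀ : Euc d}
    (hu₀ : ‖u₀‖ = 1) {η : ℝ} (hη : η < 1) {Q : Finset (Euc d)} (hQ : Q.Nonempty)
    (h : ∀ u : Euc d, ‖u‖ = 1 → |meanAbs p u - supportFn Q u| ≤ meanAbsInner u₀ * η) :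
    2 ≤ Q.card := by
  by_contra hlt
  have hcard : Q.card = 1 := by
    have := hQ.card_pos
    omega
  obtain ⟨q, rfl⟩ := Finset.card_eq_one.1 hcard
  have hm : 0 < meanAbsInner u₀ := by
    have hd : (0 : ℝ) < d := by exact_mod_cast NeZero.pos d
    exact lt_of_lt_of_le (by positivity) (le_meanAbsInner hu₀)
  have hs : ∀ u, supportFn {q} u = inner ℝ u q := fun u => by
    obtain ⟨q', hq', hqu⟩ := exists_inner_eq_supportFn hQ u
    rw [← hqu, Finset.mem_singleton.1 hq']
  -- The support function of one point is odd while `meanAbs p` is even, so adding the bounds at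
  -- `±x` cancels the site. The mean `m_d` of `meanAbs p` would then be at most `m_d η`.
  have hle : ∀ x : sphere (0 : Euc d) 1, meanAbs p x ≤ meanAbsInner u₀ * η := by
    intro x
    have h1 := (abs_le.1 (h x (norm_eq_of_mem_sphere x))).2
    have h2 := (abs_le.1 (h (-x) (by rw [norm_neg, norm_eq_of_mem_sphere x]))).2
    rw [hs] at h1 h2
    rw [meanAbs_neg, inner_neg_left] at h2
    linarith
  have hint := integral_meanAbs hN p hu₀
  have hcont : Continuous fun x : sphere (0 : Euc d) 1 => meanAbs p (x : Euc d) := by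
    unfold meanAbs
    fun_prop
  have hmono : ∫ x, meanAbs p x ∂(uniformSphere d) ≤
      ∫ _, meanAbsInner u₀ * η ∂(uniformSphere d) :=
    integral_mono (Continuous.integrable_of_compactSpace hcont) (integrable_const _) hle
  rw [hint] at hmono
  simp only [integral_const, probReal_univ, one_smul] at hmono
  nlinarith

lemma sites_lower_bound_eq {η L : ℝ} (hd : 1 ≤ d) (hη : 0 < η) (hL : 0 < L)
    (hNeq : (N : ℝ) = (d : ℝ) / η ^ 2 * L) :
    2 * Real.sqrt d * ((N : ℝ) / (64 * d * L)) ^ (((d : ℝ) - 1) / 4) =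
      2 * Real.sqrt d * Real.sqrt (1 / (8 * η)) ^ (d - 1) := by
  have hd0 : (0 : ℝ) < d := by exact_mod_cast hd
  congr 1
  have h1 : (N : ℝ) / (64 * d * L) = Real.sqrt (1 / (8 * η)) ^ (4 : ℝ) := by
    rw [show (4 : ℝ) = ((4 : ℕ) : ℝ) by norm_num, Real.rpow_natCast,
      show Real.sqrt (1 / (8 * η)) ^ 4 = (Real.sqrt (1 / (8 * η)) ^ 2) ^ 2 by ring,
      Real.sq_sqrt (by positivity), hNeq]
    field_simp
    norm_num
  rw [h1, ← Real.rpow_mul (Real.sqrt_nonneg _), ← Real.rpow_natCast, Nat.cast_sub hd]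
  congr 1
  push_cast
  ring

lemma sites_lower_bound_sq {η : ℝ} (hη : 0 < η) :
    (2 * Real.sqrt d * Real.sqrt (1 / (8 * η)) ^ (d - 1)) ^ 2 =
      4 * d * (1 / (8 * η)) ^ (d - 1) := by
  rw [mul_pow, mul_pow, Real.sq_sqrt (Nat.cast_nonneg d), ← pow_mul, mul_comm (d - 1), pow_mul,
    Real.sq_sqrt (by positivity)]
  norm_num

/-- From `n₀` on, consecutive terms have ratio `(n + 2) y / (n + 1) ≤ 1`. -/
lemma four_mul_mul_pow_le_one {n₀ n : ℕ} {y : ℝ} (hy0 : 0 ≤ y) (hy : (n₀ + 2) * y ≤ n₀ + 1)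
    (h₀ : 4 * ((n₀ : ℝ) + 1) * y ^ n₀ ≤ 1) (hn : n₀ ≤ n) : 4 * ((n : ℝ) + 1) * y ^ n ≤ 1 := by
  induction n, hn using Nat.le_induction with
  | base => exact h₀
  | succ n hn ih =>
    have hn' : (n₀ : ℝ) ≤ n := by exact_mod_cast hn
    have hy1 : y ≤ 1 := by
      by_contra h
      nlinarith [(Nat.cast_nonneg n₀ : (0 : ℝ) ≤ n₀)]
    have hstep : ((n : ℝ) + 2) * y ≤ n + 1 := by nlinarith
    have hyn := pow_nonneg hy0 n
    push_cast
    calc 4 * ((n : ℝ) + 1 + 1) * y ^ (n + 1) = 4 * (((n : ℝ) + 2) * y) * y ^ n := by ring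
      _ ≤ 4 * ((n : ℝ) + 1) * y ^ n := by gcongr
      _ ≤ 1 := ih

/-- In moderate dimension, or for large `η`, the asserted lower bound is at most one. -/
lemma sites_lower_bound_sq_le_one (hd : 3 ≤ d) {η : ℝ} (hη : 1 / 5 ≤ η) (hdη : 1 / η ^ 2 ≤ (d : ℝ)) :
    4 * (d : ℝ) * (1 / (8 * η)) ^ (d - 1) ≤ 1 := by
  have hη0 : 0 < η := by linarith
  set y := 1 / (8 * η) with hy
  have hy0 : 0 < y := by positivity
  have hy1 : y ≤ 5 / 8 := by
    rw [hy, div_le_iff₀ (by positivity)]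
    linarith
  have hy2 : 64 * y ^ 2 ≤ d := by
    refine le_trans (le_of_eq ?_) hdη
    rw [hy]
    field_simp
    norm_num
  rcases le_or_gt 9 d with h9 | h9
  · obtain ⟨k, rfl⟩ := Nat.exists_eq_add_of_le' (show 1 ≤ d by omega)
    have h8 : y ^ 8 ≤ (5 / 8) ^ 8 := pow_le_pow_left₀ hy0.le hy1 8
    have := four_mul_mul_pow_le_one (n₀ := 8) (n := k) hy0.le (by push_cast; linarith)
      (by push_cast; nlinarith) (by omega)
    simpa using this
  · rcases le_or_gt 5 d with h5 | h5
    · have hd8 : (d : ℝ) ≤ 8 := by exact_mod_cast (show d ≤ 8 by omega)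
      have h4 : y ^ (d - 1) ≤ y ^ 4 := pow_le_pow_of_le_one hy0.le (by linarith) (by omega)
      have hy8 : y ^ 2 ≤ 1 / 8 := by linarith
      have h6 : y ^ 4 ≤ 1 / 64 := by nlinarith [sq_nonneg y]
      have h7 : y ^ (d - 1) ≤ 1 / 64 := h4.trans h6
      nlinarith [pow_nonneg hy0.le (d - 1)]
    · interval_cases d
      · norm_num at hy2 ⊢
        linarith
      · norm_num at hy2 ⊢
        have h3 : y ^ 3 ≤ 1 / 16 * (5 / 8) := by
          rw [pow_succ]
          gcongr
          linarith
        linarith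

lemma le_one_of_sq_le_one {x : ℝ} (h : x ^ 2 ≤ 1) : x ≤ 1 := by nlinarith

end Complexity

theorem theorem2 (κ : ℝ) (hκ : 0 < κ) :
    ∃ C : ℝ, 0 < C ∧
      ∀ (d : ℕ), 2 ≤ d → ∀ (η : ℝ), 0 < η → 1 / η ^ 2 ≤ (d : ℝ) →
      ∀ (N : ℕ), (N : ℝ) = (d : ℝ) / η ^ 2 * (Real.log d + C) →
      -- `u` is an arbitrary unit vector, so that `meanAbsInner u` is `m_d`
      ∀ (u : Euc d), ‖u‖ = 1 →
      -- `N` independent uniform random points on the unit sphere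
      ∀ (Ω : Type*) [MeasurableSpace Ω] (μ : Measure Ω) [IsProbabilityMeasure μ]
        (p : Fin N → Ω → sphere (0 : Euc d) 1),
        (∀ i, Measurable (p i)) → iIndepFun p μ → (∀ i, μ.map (p i) = uniformSphere d) →
      -- the inequality holds on a measurable event of probability at least `1 - exp (-κ d)`
      ∃ A : Set Ω, MeasurableSet A ∧ 1 - Real.exp (-κ * d) ≤ μ.real A ∧
        ∀ ω ∈ A,
          2 * Real.sqrt d * ((N : ℝ) / (64 * d * (Real.log d + C))) ^ (((d : ℝ) - 1) / 4) ≤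
            (epsComplexity (kDist (symmCloud fun i => p i ω) N) (meanAbsInner u * η) : ℝ) := by
  -- `32000000 = 62500 · 512`: `62500 = 250²` comes from the lower bound on `m²`, and `512 = 16 ·
  -- 32` from `s² = m² η² / 16` and the deviation exponent. The `+ 2` pays for `d / 4` and the
  -- prefactor `2`.
  refine ⟨32000000 * (κ + 2), by positivity, ?_⟩
  intro d hd2 η hη hdη N hNeq u hu Ω _ μ _ p hp hind hlaw
  set C : ℝ := 32000000 * (κ + 2) with hC
  have hd1 : 1 ≤ d := by omega
  have hd0 : (0 : ℝ) < d := by exact_mod_cast hd1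
  have hd2' : (2 : ℝ) ≤ d := by exact_mod_cast hd2
  have : NeZero d := ⟨by omega⟩
  have hC0 : 0 < C := by positivity
  have hlog : 0 ≤ Real.log d := Real.log_nonneg (by linarith)
  have hL : 0 < Real.log d + C := by linarith
  have hN : 0 < N := by
    have : (0 : ℝ) < N := by
      rw [hNeq]
      positivity
    exact_mod_cast this
  set m := meanAbsInner u with hmdef
  have hm0 : 1 / (250 * Real.sqrt d) ≤ m := le_meanAbsInner hu
  have hm : 0 < m := lt_of_lt_of_le (by positivity) hm0
  rw [sites_lower_bound_eq hd1 hη hL hNeq]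
  set R := 2 * Real.sqrt d * Real.sqrt (1 / (8 * η)) ^ (d - 1) with hR
  have hRsq : R ^ 2 = 4 * d * (1 / (8 * η)) ^ (d - 1) := sites_lower_bound_sq hη
  have hnr : μ {ω | ¬ NoRepeat fun i => p i ω} = 0 := ae_iff.1 (ae_noRepeat hd2 hp hind hlaw)
  have hnr' : μ.real {ω | ¬ NoRepeat fun i => p i ω} = 0 := by rw [measureReal_def, hnr]; rfl
  have hmη : 0 ≤ m * η := by positivity
  have hRsq2 : d = 2 → R ^ 2 = 1 / η := by
    intro h
    rw [hRsq, h]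
    norm_num
    field_simp
  have hsimple : (∀ ω, NoRepeat (fun i => p i ω) →
      R ≤ (epsComplexity (kDist (symmCloud fun i => p i ω) N) (m * η) : ℝ)) →
      ∃ A : Set Ω, MeasurableSet A ∧ 1 - Real.exp (-κ * d) ≤ μ.real A ∧
        ∀ ω ∈ A, R ≤ (epsComplexity (kDist (symmCloud fun i => p i ω) N) (m * η) : ℝ) := by
    intro h
    apply exists_measurableSet_of_measure_not_le
    refine le_trans (le_trans (measureReal_mono fun ω hω hrep => hω (h ω hrep)) hnr'.le)
      (Real.exp_pos _).le
  -- In the last case `1 / η² ≤ d` forces `d > 25`; in the middle one it gives `R ≤ 2`.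
  have hcase : R ≤ 1 ∨ (d = 2 ∧ η < 1) ∨ (3 ≤ d ∧ η < 1 / 5) := by
    rcases eq_or_lt_of_le hd2 with h | h
    · rcases lt_or_ge η 1 with h1 | h1
      · exact Or.inr (Or.inl ⟨h.symm, h1⟩)
      · left
        apply le_one_of_sq_le_one
        rw [hRsq2 h.symm]
        exact (div_le_one hη).2 h1
    · rcases lt_or_ge η (1 / 5) with h1 | h1
      · exact Or.inr (Or.inr ⟨h, h1⟩)
      · left
        apply le_one_of_sq_le_one
        rw [hRsq]
        exact sites_lower_bound_sq_le_one h h1 hdη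
  rcases hcase with hR1 | ⟨hd, hη1⟩ | ⟨hd3, hη5⟩
  · refine hsimple fun ω hrep => ?_
    obtain ⟨Q, hQ, hcard, -⟩ := exists_sites_of_epsComplexity hN hrep hmη
    rw [← hcard]
    refine hR1.trans ?_
    exact_mod_cast hQ.card_pos
  · refine hsimple fun ω hrep => ?_
    obtain ⟨Q, hQ, hcard, happ⟩ := exists_sites_of_epsComplexity hN hrep hmη
    rw [← hcard]
    have h2 : (2 : ℝ) ≤ Q.card := by exact_mod_cast two_le_card hN _ hu hη1 hQ happ
    refine le_trans (le_of_sq_le_sq ?_ (by norm_num)) h2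
    rw [hRsq2 hd, div_le_iff₀ hη]
    rw [hd, div_le_iff₀ (by positivity)] at hdη
    push_cast at hdη
    nlinarith
  · have hd25 : 25 < d := by
      have h1 : (25 : ℝ) < 1 / η ^ 2 := by
        rw [lt_div_iff₀ (by positivity)]
        nlinarith
      exact_mod_cast h1.trans_le hdη
    -- The deviation `2 s` is then half the tolerance `m η`, so the support function of the sites is
    -- within `3/2 m η` of `m`.
    set s := m * η / 4 with hs
    have hs0 : 0 < s := by positivity
    have hdev := measure_exists_abs_meanAbs_sub_gt_le' hp hind hlaw
      (fun t ht => meanAbsInner_eq ht hu) hN hs0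
    have hexp : 2 * Real.exp (-(N * s ^ 2 * d / 32) + d / 4) ≤ Real.exp (-κ * d) := by
      have hm2 : 1 / (62500 * d) ≤ m ^ 2 := by
        have := pow_le_pow_left₀ (by positivity) hm0 2
        rw [div_pow, mul_pow, Real.sq_sqrt hd0.le] at this
        norm_num at this ⊢
        exact this
      have h1 : d * (κ + 2) ≤ N * s ^ 2 * d / 32 := by
        have e : N * s ^ 2 * d / 32 = m ^ 2 * (d ^ 2 * (Real.log d + C) / 512) := by
          rw [hs, hNeq]
          field_simp
          norm_num
        rw [e]
        calc (d : ℝ) * (κ + 2) = 1 / (62500 * d) * (d ^ 2 * (0 + C) / 512) := by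
              rw [hC]
              field_simp
              ring
          _ ≤ _ := by gcongr
      have h2 : (2 : ℝ) ≤ Real.exp 1 := by linarith [Real.add_one_le_exp (1 : ℝ)]
      calc 2 * Real.exp (-(N * s ^ 2 * d / 32) + d / 4)
          ≤ Real.exp 1 * Real.exp (-(N * s ^ 2 * d / 32) + d / 4) := by gcongr
        _ ≤ _ := by
            rw [← Real.exp_add]
            apply Real.exp_le_exp.2
            nlinarith
    apply exists_measurableSet_of_measure_not_le
    refine le_trans (measureReal_mono (s₂ := {ω | ¬ NoRepeat fun i => p i ω} ∪
      {ω | ∃ v : Euc d, ‖v‖ = 1 ∧ 2 * s < |meanAbs (fun i => p i ω) v - m|}) ?_) ?_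
    · intro ω hω
      by_contra hgood
      simp only [Set.mem_union, Set.mem_ofPred_eq, not_or, not_not, not_exists, not_and,
        not_lt] at hgood
      obtain ⟨hrep, hclose⟩ := hgood
      apply hω
      obtain ⟨Q, hQ, hcard, happ⟩ := exists_sites_of_epsComplexity hN hrep hmη
      rw [← hcard]
      have hcov := one_le_card_mul_of_supportFn hd1 hQ hm (τ := 3 / 2 * η) (by positivity)
        (by linarith) fun v hv => by
          have h1 := happ v hv
          have h2 := hclose v hv
          have h3 := abs_sub_le (supportFn Q v) (meanAbs (fun i => p i ω) v) m
          rw [abs_sub_comm (supportFn Q v) (meanAbs _ v)] at h3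
          linarith
      -- After squaring, `1 / (8η)` meets `6η`, leaving `4 d (3/4)^(d-1)`, which is at most `1`
      -- because `d > 25`.
      have hprod : R * Real.sqrt (4 * (3 / 2 * η)) ^ (d - 1) ≤ 1 := by
        apply le_one_of_sq_le_one
        rw [mul_pow, hRsq, ← pow_mul, mul_comm (d - 1), pow_mul, Real.sq_sqrt (by positivity),
          mul_assoc, ← mul_pow]
        have e : 1 / (8 * η) * (4 * (3 / 2 * η)) = 3 / 4 := by
          field_simp
          norm_num
        rw [e]
        obtain ⟨k, rfl⟩ := Nat.exists_eq_add_of_le' hd1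
        have := four_mul_mul_pow_le_one (n₀ := 25) (n := k) (y := 3 / 4) (by norm_num)
          (by norm_num) (by norm_num) (by omega)
        simpa using this
      have hR0 : 0 ≤ R := by positivity
      calc R ≤ R * (Q.card * Real.sqrt (4 * (3 / 2 * η)) ^ (d - 1)) :=
            le_mul_of_one_le_right hR0 hcov
        _ = Q.card * (R * Real.sqrt (4 * (3 / 2 * η)) ^ (d - 1)) := by ring
        _ ≤ Q.card := mul_le_of_le_one_right (Nat.cast_nonneg _) hprod
    · refine (measureReal_union_le _ _).trans ?_
      rw [hnr', zero_add]
      exact hdev.trans hexp
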